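/- Let $\Bbbk$ be a field of characteristic zero and let $\mathscr P=\{\mathscr P(n)\}_{n\ge 1}$ be a $\Bbbk$-linear quadratic operad with $\mathscr P(1)=\Bbbk$; that is, $\mathscr P$ is the quotient of the free operad on the $S_2$-module $\mathscr P(2)$ by the ideal generated by relations of arity three. For a $\mathscr P$-algebra $A$ let $\mathcal U^{\mathscr P}A$ be its enveloping algebra, i.e. the associative unital algebra generated by the symbols $X(\lambda;a_1,\dots,a_n)$, $\lambda\in\mathscr P(n+1)$, $a_i\in A$, representing the operators $m\mapsto\lambda(a_1,\dots,a_n,m)$ on left $A$-modules, and put $u(\mu,a)=X(\mu;a)$ for $\mu\in\mathscr P(2)$. Let $\Omega^1_{\mathscr P}A$ be the left $\mathcal U^{\mathscr P}A$-module generated by symbols $da$ $(a\in A)$, linear in $a$, subject to $d(\mu(a_1,a_2))=u(\mu,a_1)\,da_2+u(\mu^{(12)},a_2)\,da_1$ for $\mu\in\mathscr P(2)$, $a_1,a_2\in A$. The map $a\mapsto da$ is the universal derivation $A\to\Omega^1_{\mathscr P}A$. For a left $A$-module $M$ let $\check T_AM=\bigoplus_{i\ge0}\check T^i_AM$ be the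 graded $\mathscr P$-superalgebra obtained from the free graded $\mathscr P$-superalgebra on $A\oplus M$ ($A$ in degree $0$, $M$ in degree $1$) by dividing out the two-sided ideal generated by $\mu\otimes a\otimes b-\mu(a,b)$ and $\mu\otimes b\otimes a-\mu(b,a)$ for $\mu\in\mathscr P(2)$, $a\in A$, $b\in A\oplus M$, where $\mu(a,b)$ and $\mu(b,a)$ are computed in the square-zero extension $A\oplus M$. Put $\Omega^\bullet_{\mathscr P}A=\check T_A(\Omega^1_{\mathscr P}A)$. A super-differential on a graded $\mathscr P$-superalgebra is a super-derivation $d$ of degree $1$ with $d^2=0$. Then there is a family of super-differentials $d=d_A$ on $\Omega^\bullet_{\mathscr P}A$, one for each $\mathscr P$-algebra $A$, such that: (i) for every $A$, the restriction of $d_A$ to $A$ is the universal derivation, i.e. $d_A(a)=da\in\Omega^1_{\mathscr P}A$ for $a\in A$; and $d$ is natural: for every morphism $\varphi:A\to B$ of $\mathscr P$-algebras there is a unique morphism of graded $\mathscr P$-superalgebras $\Omega^\bullet_{\mathscr P}A\to\Omega^\bullet_{\mathscr P}B$ with $a\mapsto\varphi(a)$ and $da\mapsto d(\varphi(a))$ for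 $a\in A$, and it commutes with the differentials; (ii) for every $A$, $(\Omega^\bullet_{\mathscr P}A,d_A)$ is the differential envelope of $A$: the canonical map $A\to\Omega^0_{\mathscr P}A$ is an isomorphism of $\mathscr P$-algebras, and for every differential graded $\mathscr P$-superalgebra $\widetilde D^\bullet=\bigoplus_{i\ge0}\widetilde D^i$ and every morphism of $\mathscr P$-algebras $\rho:A\to\widetilde D^0$ there is a unique morphism of differential graded $\mathscr P$-superalgebras $\Omega^\bullet_{\mathscr P}A\to\widetilde D^\bullet$ whose restriction to $A$ is $\rho$. -/

import Mathlib

universe w u v v' v''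

namespace PGeom

/-! ### Operads -/

/-- A (symmetric, unital) operad in `k`-vector spaces, in the coordinate-free form: a functor
`I ↦ obj I` on finite sets and bijections (`obj (Fin n)` with the action of the permutations of
`Fin n` is the usual `P(n)` with its `S_n`-action), an identity operation, and compositions
`obj I ⊗ ⨂ i, obj (J i) → obj (Σ i, J i)` which are equivariant, associative and unital. -/
structure Operad (k : Type w) [Field k] where
  obj : (I : Type) → [Finite I] → Type u
  [addCommGroup : ∀ (I : Type) [Finite I], AddCommGroup (obj I)]
  [module : ∀ (I : Type) [Finite I], Module k (obj I)]
  map : ∀ {I J : Type} [Finite I] [Finite J], (I ≃ J) → (obj I →ₗ[k] obj J)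
  one : obj Unit
  comp : ∀ {I : Type} [Finite I] {J : I → Type} [∀ i, Finite (J i)],
    obj I →ₗ[k] MultilinearMap k (fun i => obj (J i)) (obj (Σ i, J i))
  map_refl : ∀ {I : Type} [Finite I] (μ : obj I), map (Equiv.refl I) μ = μ
  map_trans : ∀ {I J K : Type} [Finite I] [Finite J] [Finite K] (e : I ≃ J) (f : J ≃ K)
    (μ : obj I), map (e.trans f) μ = map f (map e μ)
  comp_map_left : ∀ {I I' : Type} [Finite I] [Finite I'] {J : I' → Type} [∀ i, Finite (J i)]
    (e : I ≃ I') (μ : obj I) (ν : ∀ i, obj (J i)),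
    comp (map e μ) ν = map (Equiv.sigmaCongrLeft e) (comp μ (fun i => ν (e i)))
  comp_map_right : ∀ {I : Type} [Finite I] {J J' : I → Type} [∀ i, Finite (J i)]
    [∀ i, Finite (J' i)] (f : ∀ i, J i ≃ J' i) (μ : obj I) (ν : ∀ i, obj (J i)),
    comp μ (fun i => map (f i) (ν i)) = map (Equiv.sigmaCongrRight f) (comp μ ν)
  comp_assoc : ∀ {I : Type} [Finite I] {J : I → Type} [∀ i, Finite (J i)]
    {K : ∀ i, J i → Type} [∀ i j, Finite (K i j)]
    (μ : obj I) (ν : ∀ i, obj (J i)) (ξ : ∀ i j, obj (K i j)),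
    comp μ (fun i => comp (ν i) (ξ i)) =
      map (Equiv.sigmaAssoc K) (comp (comp μ ν) (fun p => ξ p.1 p.2))
  one_comp : ∀ {J : Type} [Finite J] (ν : obj J),
    comp one (fun _ : Unit => ν) = map (Equiv.uniqueSigma (fun _ : Unit => J)).symm ν
  comp_one : ∀ {I : Type} [Finite I] (μ : obj I),
    comp μ (fun _ : I => one) = map (Equiv.sigmaUnique I (fun _ => Unit)).symm μ

attribute [instance] Operad.addCommGroup Operad.module

section

variable {k : Type w} [Field k]

/-- Morphisms of operads. -/
structure Operad.Hom (P : Operad.{w, u} k) (Q : Operad.{w, v} k) where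
  app : ∀ (I : Type) [Finite I], P.obj I →ₗ[k] Q.obj I
  app_map : ∀ {I J : Type} [Finite I] [Finite J] (e : I ≃ J) (μ : P.obj I),
    app J (P.map e μ) = Q.map e (app I μ)
  app_one : app Unit P.one = Q.one
  app_comp : ∀ {I : Type} [Finite I] {J : I → Type} [∀ i, Finite (J i)]
    (μ : P.obj I) (ν : ∀ i, P.obj (J i)),
    app (Σ i, J i) (P.comp μ ν) = Q.comp (app I μ) (fun i => app (J i) (ν i))

/-- The index family equal to `J` at `none` and to a point elsewhere. -/
def Slot (J : Type) {I : Type} : Option I → Type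
  | none => J
  | some _ => Unit

instance (J : Type) {I : Type} [Finite J] (o : Option I) : Finite (Slot J o) := by
  cases o <;> simp only [Slot] <;> infer_instance

/-- Replacing the slot `none` of `Option I` by `J`. -/
def slotEquiv (I J : Type) : (Σ o : Option I, Slot J o) ≃ I ⊕ J where
  toFun
    | ⟨none, j⟩ => Sum.inr j
    | ⟨some i, _⟩ => Sum.inl i
  invFun
    | Sum.inl i => ⟨some i, ()⟩
    | Sum.inr j => ⟨none, j⟩
  left_inv := by rintro ⟨_ | i, j⟩ <;> rfl
  right_inv := by rintro (i | j) <;> rfl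

/-- `μ` in the slot `none`, the identity operation in all other slots. -/
def Operad.slotFill (P : Operad.{w, u} k) {I J : Type} [Finite J] (μ : P.obj J) :
    ∀ o : Option I, P.obj (Slot J o)
  | none => μ
  | some _ => P.one

/-- Partial composition: insert `μ` into the slot `none` of `l`. -/
def Operad.partialComp (P : Operad.{w, u} k) {I J : Type} [Finite I] [Finite J]
    (l : P.obj (Option I)) (μ : P.obj J) : P.obj (I ⊕ J) :=
  P.map (slotEquiv I J) (P.comp l (P.slotFill μ))

/-- Insert `μ` into the last slot of `l`: `(l ∘ μ)(a₁,…,aₙ,b₁,…,bₘ) = l(a₁,…,aₙ,μ(b₁,…,bₘ))`. -/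
def Operad.compLast (P : Operad.{w, u} k) {n m : ℕ} (l : P.obj (Fin (n + 1)))
    (μ : P.obj (Fin m)) : P.obj (Fin (n + m)) :=
  P.map finSumFinEquiv (P.partialComp (P.map finSuccEquivLast l) μ)

/-- Insert `μ` into the first slot of `l`: `(l ∘ μ)(b₁,…,bₘ,a₁,…,aₙ) = l(μ(b₁,…,bₘ),a₁,…,aₙ)`. -/
def Operad.compFirst (P : Operad.{w, u} k) {n m : ℕ} (l : P.obj (Fin (n + 1)))
    (μ : P.obj (Fin m)) : P.obj (Fin (m + n)) :=
  P.map ((Equiv.sumComm (Fin n) (Fin m)).trans finSumFinEquiv)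
    (P.partialComp (P.map (finSuccEquiv n) l) μ)

/-- The identity operation as an element of `P(1)`. -/
def Operad.one₁ (P : Operad.{w, u} k) : P.obj (Fin 1) :=
  P.map (Equiv.ofUnique Unit (Fin 1)) P.one

/-- The operation `μ^{(12)}`. -/
def Operad.flip (P : Operad.{w, u} k) (μ : P.obj (Fin 2)) : P.obj (Fin 2) :=
  P.map (Equiv.swap 0 1) μ

/-- The operad is generated by its binary operations: every suboperad (family of subspaces closed
under relabelling and composition and containing the identity) that contains all binary
operations is everything. -/
def Operad.IsBinaryGenerated (P : Operad.{w, u} k) : Prop :=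
  ∀ S : (∀ (I : Type) [Finite I], Submodule k (P.obj I)),
    (∀ {I J : Type} [Finite I] [Finite J] (e : I ≃ J) (μ : P.obj I), μ ∈ S I → P.map e μ ∈ S J) →
    P.one ∈ S Unit →
    (∀ {I : Type} [Finite I] {J : I → Type} [∀ i, Finite (J i)] (μ : P.obj I)
      (ν : ∀ i, P.obj (J i)), μ ∈ S I → (∀ i, ν i ∈ S (J i)) → P.comp μ ν ∈ S (Σ i, J i)) →
    (∀ μ : P.obj (Fin 2), μ ∈ S (Fin 2)) →
    ∀ (I : Type) [Finite I] (μ : P.obj I), μ ∈ S I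

/-- The ternary operation obtained by inserting the binary operation `ν` into one slot of the
binary operation `μ` and numbering the three free slots by `e'`. -/
def Operad.quad (P : Operad.{w, u} k) (e : Fin 2 ≃ Option Unit) (e' : Unit ⊕ Fin 2 ≃ Fin 3)
    (μ ν : P.obj (Fin 2)) : P.obj (Fin 3) :=
  P.map e' (P.partialComp (P.map e μ) ν)

/-- Quadratic operads: `P` is generated by `E = P(2)`, and all relations follow from those among
the composites of two binary operations, i.e. `P` has the universal property of the quotient
`F(E)/(R)` of the free operad by the ideal generated by `R = Ker (F(E)(3) → P(3))`: every
equivariant linear map from `P(2)` to the binary part of an operad `Q` that sends the relations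
of arity three of `P` to zero extends to a morphism of operads `P → Q`. -/
structure Operad.IsQuadratic (P : Operad.{w, u} k) : Prop where
  generated : P.IsBinaryGenerated
  presented : ∀ (Q : Operad.{w, u} k) (f : P.obj (Fin 2) →ₗ[k] Q.obj (Fin 2)),
    (∀ μ, f (P.flip μ) = Q.flip (f μ)) →
    (∀ (n : ℕ) (e : Fin n → (Fin 2 ≃ Option Unit)) (e' : Fin n → (Unit ⊕ Fin 2 ≃ Fin 3))
      (μ ν : Fin n → P.obj (Fin 2)),
      ∑ t, P.quad (e t) (e' t) (μ t) (ν t) = 0 →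
      ∑ t, Q.quad (e t) (e' t) (f (μ t)) (f (ν t)) = 0) →
    ∃ F : P.Hom Q, F.app (Fin 2) = f

/-! ### Algebras and graded superalgebras over an operad -/

/-- Algebras over an operad. -/
structure Operad.Alg (P : Operad.{w, u} k) where
  carrier : Type v
  [addCommGroup : AddCommGroup carrier]
  [module : Module k carrier]
  op : ∀ {n : ℕ}, P.obj (Fin n) →ₗ[k] MultilinearMap k (fun _ : Fin n => carrier) carrier
  op_perm : ∀ {n : ℕ} (σ : Equiv.Perm (Fin n)) (μ : P.obj (Fin n)) (x : Fin n → carrier),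
    op (P.map σ μ) x = op μ (fun i => x (σ i))
  op_one : ∀ x : Fin 1 → carrier, op P.one₁ x = x 0
  op_comp : ∀ {n : ℕ} {m : Fin n → ℕ} (μ : P.obj (Fin n)) (ν : ∀ i, P.obj (Fin (m i)))
    (x : Fin (∑ i, m i) → carrier),
    op (P.map finSigmaFinEquiv (P.comp μ ν)) x =
      op μ (fun i => op (ν i) (fun j => x (finSigmaFinEquiv ⟨i, j⟩)))

attribute [instance] Operad.Alg.addCommGroup Operad.Alg.module

/-- Morphisms of `P`-algebras. -/
structure Operad.Alg.Hom {P : Operad.{w, u} k} (A : Operad.Alg.{w, u, v} P)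
    (B : Operad.Alg.{w, u, v'} P) where
  toFun : A.carrier →ₗ[k] B.carrier
  map_op : ∀ {n : ℕ} (μ : P.obj (Fin n)) (x : Fin n → A.carrier),
    toFun (A.op μ x) = B.op μ (fun i => toFun (x i))

/-- The Koszul sign of reordering homogeneous elements `x 0, x 1, …` of degrees `d 0, d 1, …`
into `x (σ 0), x (σ 1), …`. -/
def koszulSign (k : Type w) [Field k] {n : ℕ} (σ : Equiv.Perm (Fin n)) (d : Fin n → ℕ) : k :=
  ∏ i, ∏ j, if i < j ∧ σ j < σ i then (-1) ^ (d (σ i) * d (σ j)) else 1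

/-- Graded `P`-superalgebras `⨁ i ≥ 0, obj i`: algebras over `P` (placed in degree zero) in the
symmetric monoidal category of graded super vector spaces. The degree `e` of the result of an
operation is carried along with a proof that it is the sum of the degrees of the arguments. -/
structure Operad.SuperAlg (P : Operad.{w, u} k) where
  obj : ℕ → Type v
  [addCommGroup : ∀ i, AddCommGroup (obj i)]
  [module : ∀ i, Module k (obj i)]
  op : ∀ {n : ℕ} (d : Fin n → ℕ) {e : ℕ}, ∑ i, d i = e →
    (P.obj (Fin n) →ₗ[k] MultilinearMap k (fun i : Fin n => obj (d i)) (obj e))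
  op_perm : ∀ {n : ℕ} (σ : Equiv.Perm (Fin n)) (d : Fin n → ℕ) {e : ℕ} (h : ∑ i, d i = e)
    (h' : ∑ i, d (σ i) = e) (μ : P.obj (Fin n)) (x : ∀ i, obj (d i)),
    op d h (P.map σ μ) x = koszulSign k σ d • op (fun i => d (σ i)) h' μ (fun i => x (σ i))
  op_one : ∀ {e : ℕ} (h : ∑ _i : Fin 1, e = e) (x : Fin 1 → obj e),
    op (fun _ => e) h P.one₁ x = x 0
  op_comp : ∀ {n : ℕ} {m : Fin n → ℕ} (d : Fin (∑ i, m i) → ℕ) (c : Fin n → ℕ) {e : ℕ}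
    (hc : ∀ i, ∑ j, d (finSigmaFinEquiv ⟨i, j⟩) = c i) (h : ∑ p, d p = e) (h' : ∑ i, c i = e)
    (μ : P.obj (Fin n)) (ν : ∀ i, P.obj (Fin (m i))) (x : ∀ p, obj (d p)),
    op d h (P.map finSigmaFinEquiv (P.comp μ ν)) x =
      op c h' μ (fun i => op (fun j => d (finSigmaFinEquiv ⟨i, j⟩)) (hc i) (ν i)
        (fun j => x (finSigmaFinEquiv ⟨i, j⟩)))

attribute [instance] Operad.SuperAlg.addCommGroup Operad.SuperAlg.module

/-- Morphisms of graded `P`-superalgebras. -/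
@[ext]
structure Operad.SuperAlg.Hom {P : Operad.{w, u} k} (X : Operad.SuperAlg.{w, u, v} P)
    (Y : Operad.SuperAlg.{w, u, v'} P) where
  app : ∀ i, X.obj i →ₗ[k] Y.obj i
  map_op : ∀ {n : ℕ} (d : Fin n → ℕ) {e : ℕ} (h : ∑ i, d i = e) (μ : P.obj (Fin n))
    (x : ∀ i, X.obj (d i)), app e (X.op d h μ x) = Y.op d h μ (fun i => app (d i) (x i))

theorem koszulSign_zero {n : ℕ} (σ : Equiv.Perm (Fin n)) :
    koszulSign k σ (fun _ => 0) = 1 := by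
  simp [koszulSign]

/-- The degree zero part of a graded superalgebra, a `P`-algebra. -/
def Operad.SuperAlg.zeroPart {P : Operad.{w, u} k} (X : Operad.SuperAlg.{w, u, v} P) :
    Operad.Alg.{w, u, v} P where
  carrier := X.obj 0
  op := X.op (fun _ => 0) (by simp)
  op_perm σ μ x := by
    rw [X.op_perm σ (fun _ => 0) (by simp) (by simp), koszulSign_zero, one_smul]
  op_one x := X.op_one (by simp) x
  op_comp μ ν x := X.op_comp (fun _ => 0) (fun _ => 0) (by simp) (by simp) (by simp) μ ν x

/-- The degrees `d` with the degree in position `i` raised by one. -/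
def bumpDeg {n : ℕ} (d : Fin n → ℕ) (i j : Fin n) : ℕ :=
  cond (decide (j = i)) (d j + 1) (d j)

theorem sum_bumpDeg {n : ℕ} (d : Fin n → ℕ) {e : ℕ} (h : ∑ j, d j = e) (i : Fin n) :
    ∑ j, bumpDeg d i j = e + 1 := by
  have : ∀ j, bumpDeg d i j = d j + if j = i then 1 else 0 := by
    intro j
    by_cases hj : j = i <;> simp [bumpDeg, hj]
  simp [this, Finset.sum_add_distrib, h]

/-- Apply `δ` if `b` is true, and do nothing otherwise. -/
def applyIf {X : ℕ → Type v} (δ : ∀ i, X i → X (i + 1)) {a : ℕ} (x : X a) :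
    ∀ b : Bool, X (cond b (a + 1) a)
  | true => δ a x
  | false => x

/-- Apply `δ` to the entry `x i` of a family `x` of homogeneous elements. -/
def applyAt {X : ℕ → Type v} (δ : ∀ i, X i → X (i + 1)) {n : ℕ} {d : Fin n → ℕ}
    (x : ∀ j, X (d j)) (i j : Fin n) : X (bumpDeg d i j) :=
  applyIf δ (x j) (decide (j = i))

/-- Super-differentials on a graded `P`-superalgebra: super-derivations of degree one and of
square zero. -/
structure Operad.SuperAlg.Differential {P : Operad.{w, u} k}
    (X : Operad.SuperAlg.{w, u, v} P) where
  δ : ∀ i, X.obj i →ₗ[k] X.obj (i + 1)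
  leibniz : ∀ {n : ℕ} (d : Fin n → ℕ) {e : ℕ} (h : ∑ i, d i = e) (μ : P.obj (Fin n))
    (x : ∀ i, X.obj (d i)),
    δ e (X.op d h μ x) = ∑ i, (-1 : k) ^ (∑ j ∈ Finset.univ.filter (· < i), d j) •
      X.op (bumpDeg d i) (sum_bumpDeg d h i) μ (applyAt (X := X.obj) (fun a => δ a) x i)
  sq_zero : ∀ i (x : X.obj i), δ (i + 1) (δ i x) = 0

/-- A morphism of graded superalgebras that commutes with the given differentials. -/
def Operad.SuperAlg.Hom.IsDG {P : Operad.{w, u} k} {X : Operad.SuperAlg.{w, u, v} P}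
    {Y : Operad.SuperAlg.{w, u, v'} P} (F : X.Hom Y) (dX : X.Differential)
    (dY : Y.Differential) : Prop :=
  ∀ i (x : X.obj i), F.app (i + 1) (dX.δ i x) = dY.δ i (F.app i x)

/-- `(D, d)` is the differential envelope of `A`, where `ι` is the identification of `A` with the
degree zero part of `D`: `ι` is an isomorphism of `P`-algebras, and every morphism of `P`-algebras
from `A` to the degree zero part of a differential graded `P`-superalgebra `D'` extends uniquely
to a morphism of differential graded `P`-superalgebras `D → D'`. -/
structure IsDifferentialEnvelope {P : Operad.{w, u} k} (A : Operad.Alg.{w, u, v} P)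
    (D : Operad.SuperAlg.{w, u, v'} P) (d : D.Differential) (ι : A.carrier → D.obj 0) : Prop where
  iso : ∃ f : A.Hom D.zeroPart, Function.Bijective f.toFun ∧ ∀ a, f.toFun a = ι a
  universal : ∀ (D' : Operad.SuperAlg.{w, u, v''} P) (d' : D'.Differential)
    (ρ : A.Hom D'.zeroPart),
    ∃! F : D.Hom D', F.IsDG d d' ∧ ∀ a, F.app 0 (ι a) = ρ.toFun a

/-! ### The enveloping algebra and Kähler differentials -/

section Envelope

variable {P : Operad.{w, u} k} (A : Operad.Alg.{w, u, v} P)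

/-- The symbols `X(l; a₁,…,aₙ)`, with `l ∈ P(n+1)`, that generate the enveloping algebra. -/
abbrev EnvGen : Type (max u v) := Σ n : ℕ, P.obj (Fin (n + 1)) × (Fin n → A.carrier)

/-- The generator `X(l; a₁,…,aₙ)` in the free associative algebra. -/
def envX {n : ℕ} (l : P.obj (Fin (n + 1))) (a : Fin n → A.carrier) : FreeAlgebra k (EnvGen A) :=
  FreeAlgebra.ι k ⟨n, l, a⟩

/-- A permutation of the first `n` slots, extended by fixing the last one. -/
def permFixLast {n : ℕ} (σ : Equiv.Perm (Fin n)) : Equiv.Perm (Fin (n + 1)) :=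
  (finSuccEquivLast.trans (Equiv.optionCongr σ)).trans finSuccEquivLast.symm

/-- The relations of the enveloping algebra; `X(l; a₁,…,aₙ)` stands for the operator
`m ↦ l(a₁,…,aₙ,m)` on left modules. -/
inductive EnvRel : FreeAlgebra k (EnvGen A) → FreeAlgebra k (EnvGen A) → Prop
  | add_left {n : ℕ} (l l' : P.obj (Fin (n + 1))) (a : Fin n → A.carrier) :
      EnvRel (envX A (l + l') a) (envX A l a + envX A l' a)
  | smul_left {n : ℕ} (c : k) (l : P.obj (Fin (n + 1))) (a : Fin n → A.carrier) :
      EnvRel (envX A (c • l) a) (c • envX A l a)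
  | add_arg {n : ℕ} (l : P.obj (Fin (n + 1))) (a : Fin n → A.carrier) (i : Fin n)
      (y z : A.carrier) :
      EnvRel (envX A l (Function.update a i (y + z)))
        (envX A l (Function.update a i y) + envX A l (Function.update a i z))
  | smul_arg {n : ℕ} (l : P.obj (Fin (n + 1))) (a : Fin n → A.carrier) (i : Fin n) (c : k)
      (y : A.carrier) :
      EnvRel (envX A l (Function.update a i (c • y))) (c • envX A l (Function.update a i y))
  | perm {n : ℕ} (σ : Equiv.Perm (Fin n)) (l : P.obj (Fin (n + 1))) (a : Fin n → A.carrier) :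
      EnvRel (envX A (P.map (permFixLast σ) l) a) (envX A l (fun i => a (σ i)))
  | one (a : Fin 0 → A.carrier) : EnvRel (envX A P.one₁ a) 1
  | mul {n m : ℕ} (l : P.obj (Fin (n + 1))) (l' : P.obj (Fin (m + 1)))
      (a : Fin n → A.carrier) (b : Fin m → A.carrier) :
      EnvRel (envX A l a * envX A l' b) (envX A (n := n + m) (P.compLast (n := n) l l') (Fin.append a b))
  | insert {n m : ℕ} (l : P.obj (Fin (n + 1 + 1))) (μ : P.obj (Fin m))
      (b : Fin m → A.carrier) (a : Fin n → A.carrier) :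
      EnvRel (envX A l (Fin.cons (A.op μ b) a))
        (envX A (n := m + n) (P.compFirst (n := n + 1) l μ) (Fin.append b a))

/-- The enveloping algebra of the `P`-algebra `A`: an associative unital algebra whose left
modules are the left `A`-modules. -/
def EnvAlg : Type (max w u v) := RingQuot (EnvRel A)

noncomputable instance : Ring (EnvAlg A) := inferInstanceAs (Ring (RingQuot (EnvRel A)))

noncomputable instance : Algebra k (EnvAlg A) :=
  inferInstanceAs (Algebra k (RingQuot (EnvRel A)))

/-- The standard generator `u(μ, a)`, acting on left modules by `m ↦ μ(a, m)`. -/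
def envU (μ : P.obj (Fin 2)) (a : A.carrier) : EnvAlg A :=
  RingQuot.mkAlgHom k (EnvRel A) (envX A (n := 1) μ (fun _ => a))

/-- The relations between the symbols `da` in the free left module on them. -/
inductive KahlerRel : (A.carrier →₀ EnvAlg A) → Prop
  | linear (c c' : k) (a a' : A.carrier) :
      KahlerRel (Finsupp.single (c • a + c' • a') 1 -
        (algebraMap k (EnvAlg A) c • Finsupp.single a 1 +
          algebraMap k (EnvAlg A) c' • Finsupp.single a' 1))
  | leibniz (μ : P.obj (Fin 2)) (a a' : A.carrier) :
      KahlerRel (Finsupp.single (A.op μ ![a, a']) 1 -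
        (envU A μ a • Finsupp.single a' 1 + envU A (P.flip μ) a' • Finsupp.single a 1))

/-- The left module of Kähler differentials of `A`. -/
abbrev Kahler : Type (max w u v) :=
  (A.carrier →₀ EnvAlg A) ⧸ Submodule.span (EnvAlg A) {x | KahlerRel A x}

/-- The universal derivation `a ↦ da`. -/
noncomputable def kahlerD (a : A.carrier) : Kahler A :=
  Submodule.Quotient.mk (Finsupp.single a 1)

/-! ### The tensor superalgebra of a left module -/

variable (M : Type v') [AddCommGroup M] [Module (EnvAlg A) M]

/-- Formal expressions built from elements of `A` (degree `0`) and of `M` (degree `1`) by linear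
combinations and operations of `P`. -/
inductive TExpr : ℕ → Type (max w u v v')
  | ofA : A.carrier → TExpr 0
  | ofM : M → TExpr 1
  | zero (e : ℕ) : TExpr e
  | add {e : ℕ} : TExpr e → TExpr e → TExpr e
  | smul {e : ℕ} : k → TExpr e → TExpr e
  | op {n : ℕ} (d : Fin n → ℕ) {e : ℕ} (h : ∑ i, d i = e) (μ : P.obj (Fin n))
      (x : ∀ i, TExpr (d i)) : TExpr e

/-- Two homogeneous entries as a family indexed by `Fin 2`. -/
def pair {X : ℕ → Type v} {p q : ℕ} (x : X p) (y : X q) : ∀ i : Fin 2, X (![p, q] i)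
  | 0 => x
  | 1 => y

/-- The congruence on formal expressions that is generated by the axioms of graded
`P`-superalgebras, the linearity of `A` and `M`, and the relations `μ ⊗ a ⊗ b = μ(a,b)` and
`μ ⊗ b ⊗ a = μ(b,a)` for binary `μ`, `a ∈ A`, `b ∈ A ⊕ M`, where the right hand sides are computed
in the square-zero extension `A ⊕ M`. -/
inductive TRel : ∀ {e : ℕ}, TExpr A M e → TExpr A M e → Prop
  | refl {e : ℕ} (x : TExpr A M e) : TRel x x
  | symm {e : ℕ} {x y : TExpr A M e} : TRel x y → TRel y x
  | trans {e : ℕ} {x y z : TExpr A M e} : TRel x y → TRel y z → TRel x z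
  | add_congr {e : ℕ} {x x' y y' : TExpr A M e} :
      TRel x x' → TRel y y' → TRel (.add x y) (.add x' y')
  | smul_congr {e : ℕ} (c : k) {x x' : TExpr A M e} : TRel x x' → TRel (.smul c x) (.smul c x')
  | op_congr {n : ℕ} (d : Fin n → ℕ) {e : ℕ} (h : ∑ i, d i = e) (μ : P.obj (Fin n))
      {x x' : ∀ i, TExpr A M (d i)} :
      (∀ i, TRel (x i) (x' i)) → TRel (.op d h μ x) (.op d h μ x')
  | add_assoc {e : ℕ} (x y z : TExpr A M e) : TRel (.add (.add x y) z) (.add x (.add y z))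
  | add_comm {e : ℕ} (x y : TExpr A M e) : TRel (.add x y) (.add y x)
  | zero_add {e : ℕ} (x : TExpr A M e) : TRel (.add (.zero e) x) x
  | neg_add {e : ℕ} (x : TExpr A M e) : TRel (.add (.smul (-1) x) x) (.zero e)
  | one_smul {e : ℕ} (x : TExpr A M e) : TRel (.smul 1 x) x
  | mul_smul {e : ℕ} (c c' : k) (x : TExpr A M e) :
      TRel (.smul (c * c') x) (.smul c (.smul c' x))
  | smul_add {e : ℕ} (c : k) (x y : TExpr A M e) :
      TRel (.smul c (.add x y)) (.add (.smul c x) (.smul c y))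
  | add_smul {e : ℕ} (c c' : k) (x : TExpr A M e) :
      TRel (.smul (c + c') x) (.add (.smul c x) (.smul c' x))
  | op_add_left {n : ℕ} (d : Fin n → ℕ) {e : ℕ} (h : ∑ i, d i = e) (μ μ' : P.obj (Fin n))
      (x : ∀ i, TExpr A M (d i)) :
      TRel (.op d h (μ + μ') x) (.add (.op d h μ x) (.op d h μ' x))
  | op_smul_left {n : ℕ} (d : Fin n → ℕ) {e : ℕ} (h : ∑ i, d i = e) (c : k)
      (μ : P.obj (Fin n)) (x : ∀ i, TExpr A M (d i)) :
      TRel (.op d h (c • μ) x) (.smul c (.op d h μ x))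
  | op_add_arg {n : ℕ} (d : Fin n → ℕ) {e : ℕ} (h : ∑ i, d i = e) (μ : P.obj (Fin n))
      (x : ∀ i, TExpr A M (d i)) (i : Fin n) (y z : TExpr A M (d i)) :
      TRel (.op d h μ (Function.update x i (.add y z)))
        (.add (.op d h μ (Function.update x i y)) (.op d h μ (Function.update x i z)))
  | op_smul_arg {n : ℕ} (d : Fin n → ℕ) {e : ℕ} (h : ∑ i, d i = e) (μ : P.obj (Fin n))
      (x : ∀ i, TExpr A M (d i)) (i : Fin n) (c : k) (y : TExpr A M (d i)) :
      TRel (.op d h μ (Function.update x i (.smul c y)))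
        (.smul c (.op d h μ (Function.update x i y)))
  | op_perm {n : ℕ} (σ : Equiv.Perm (Fin n)) (d : Fin n → ℕ) {e : ℕ} (h : ∑ i, d i = e)
      (h' : ∑ i, d (σ i) = e) (μ : P.obj (Fin n)) (x : ∀ i, TExpr A M (d i)) :
      TRel (.op d h (P.map σ μ) x)
        (.smul (koszulSign k σ d) (.op (fun i => d (σ i)) h' μ (fun i => x (σ i))))
  | op_one {e : ℕ} (h : ∑ _i : Fin 1, e = e) (x : Fin 1 → TExpr A M e) :
      TRel (.op (fun _ => e) h P.one₁ x) (x 0)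
  | op_comp {n : ℕ} {m : Fin n → ℕ} (d : Fin (∑ i, m i) → ℕ) (c : Fin n → ℕ) {e : ℕ}
      (hc : ∀ i, ∑ j, d (finSigmaFinEquiv ⟨i, j⟩) = c i) (h : ∑ p, d p = e)
      (h' : ∑ i, c i = e) (μ : P.obj (Fin n)) (ν : ∀ i, P.obj (Fin (m i)))
      (x : ∀ p, TExpr A M (d p)) :
      TRel (.op d h (P.map finSigmaFinEquiv (P.comp μ ν)) x)
        (.op c h' μ (fun i => .op (fun j => d (finSigmaFinEquiv ⟨i, j⟩)) (hc i) (ν i)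
          (fun j => x (finSigmaFinEquiv ⟨i, j⟩))))
  | ofA_add (a b : A.carrier) : TRel (.ofA (a + b)) (.add (.ofA a) (.ofA b))
  | ofA_smul (c : k) (a : A.carrier) : TRel (.ofA (c • a)) (.smul c (.ofA a))
  | ofM_add (m m' : M) : TRel (.ofM (m + m')) (.add (.ofM m) (.ofM m'))
  | ofM_smul (c : k) (m : M) :
      TRel (.ofM (algebraMap k (EnvAlg A) c • m)) (.smul c (.ofM m))
  | rel_AA (μ : P.obj (Fin 2)) (a b : A.carrier) :
      TRel (.op ![0, 0] (by simp) μ (pair (.ofA a) (.ofA b))) (.ofA (A.op μ ![a, b]))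
  | rel_AM (μ : P.obj (Fin 2)) (a : A.carrier) (m : M) :
      TRel (.op ![0, 1] (by simp) μ (pair (.ofA a) (.ofM m))) (.ofM (envU A μ a • m))
  | rel_MA (μ : P.obj (Fin 2)) (m : M) (a : A.carrier) :
      TRel (.op ![1, 0] (by simp) μ (pair (.ofM m) (.ofA a))) (.ofM (envU A (P.flip μ) a • m))

/-- The congruence `TRel` as a setoid. -/
instance tSetoid (e : ℕ) : Setoid (TExpr A M e) where
  r := TRel A M
  iseqv := ⟨TRel.refl, TRel.symm, TRel.trans⟩

/-- The degree `e` part of the tensor superalgebra. -/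
def TObj (e : ℕ) : Type (max w u v v') := Quotient (tSetoid A M e)

/-- The class of an expression. -/
def tmk {e : ℕ} (x : TExpr A M e) : TObj A M e := Quotient.mk (tSetoid A M e) x

variable {A M}

theorem tmk_eq {e : ℕ} {x y : TExpr A M e} (h : TRel A M x y) : tmk A M x = tmk A M y :=
  Quotient.sound h

/-- A representative of a class. -/
noncomputable def TObj.rep {e : ℕ} (x : TObj A M e) : TExpr A M e := Quotient.out x

theorem tmk_rep {e : ℕ} (x : TObj A M e) : tmk A M x.rep = x := Quotient.out_eq x

theorem rep_tmk {e : ℕ} (x : TExpr A M e) : TRel A M (tmk A M x).rep x := Quotient.mk_out x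

theorem tind {e : ℕ} {p : TObj A M e → Prop} (h : ∀ x, p (tmk A M x)) (x : TObj A M e) : p x :=
  Quotient.ind h x

instance (e : ℕ) : Zero (TObj A M e) := ⟨tmk A M (.zero e)⟩

instance (e : ℕ) : Add (TObj A M e) :=
  ⟨Quotient.map₂ TExpr.add fun _ _ h _ _ h' => TRel.add_congr h h'⟩

instance (e : ℕ) : SMul k (TObj A M e) :=
  ⟨fun c => Quotient.map (TExpr.smul c) fun _ _ h => TRel.smul_congr c h⟩

theorem tmk_add {e : ℕ} (x y : TExpr A M e) : tmk A M (.add x y) = tmk A M x + tmk A M y := rfl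

theorem tmk_smul {e : ℕ} (c : k) (x : TExpr A M e) : tmk A M (.smul c x) = c • tmk A M x := rfl

theorem tmk_zero (e : ℕ) : tmk A M (.zero e) = 0 := rfl

instance (e : ℕ) : AddCommGroup (TObj A M e) where
  add_assoc x y z := by
    induction x using tind
    induction y using tind
    induction z using tind
    exact tmk_eq (.add_assoc _ _ _)
  add_comm x y := by
    induction x using tind
    induction y using tind
    exact tmk_eq (.add_comm _ _)
  zero_add x := by
    induction x using tind
    exact tmk_eq (.zero_add _)
  add_zero x := by
    induction x using tind
    exact tmk_eq ((TRel.add_comm _ _).trans (.zero_add _))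
  nsmul := nsmulRec
  neg x := (-1 : k) • x
  zsmul := @zsmulRec _ ⟨0⟩ _ ⟨fun x => (-1 : k) • x⟩ (@nsmulRec _ ⟨0⟩ _)
  neg_add_cancel x := by
    induction x using tind
    exact tmk_eq (.neg_add _)

instance (e : ℕ) : Module k (TObj A M e) where
  one_smul x := by
    induction x using tind
    exact tmk_eq (.one_smul _)
  mul_smul c c' x := by
    induction x using tind
    exact tmk_eq (.mul_smul _ _ _)
  smul_add c x y := by
    induction x using tind
    induction y using tind
    exact tmk_eq (.smul_add _ _ _)
  add_smul c c' x := by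
    induction x using tind
    exact tmk_eq (.add_smul _ _ _)
  smul_zero c := by
    have h : c • (0 : TObj A M e) + c • (0 : TObj A M e) = c • (0 : TObj A M e) := by
      have := tmk_eq (TRel.smul_add c (TExpr.zero (A := A) (M := M) e) (.zero e))
      rw [tmk_smul, tmk_add, tmk_add, tmk_smul, tmk_zero, _root_.zero_add] at this
      exact this.symm
    simpa using h
  zero_smul x := by
    induction x using tind with
    | h x =>
      have := tmk_eq (TRel.add_smul (0 : k) 0 x)
      rw [tmk_add, tmk_smul, tmk_smul, _root_.zero_add] at this
      simpa using this

/-- The operation of `P` on classes. -/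
noncomputable def tOp {n : ℕ} (d : Fin n → ℕ) {e : ℕ} (h : ∑ i, d i = e) (μ : P.obj (Fin n))
    (x : ∀ i, TObj A M (d i)) : TObj A M e :=
  tmk A M (.op d h μ (fun i => (x i).rep))

theorem tOp_tmk {n : ℕ} (d : Fin n → ℕ) {e : ℕ} (h : ∑ i, d i = e) (μ : P.obj (Fin n))
    (x : ∀ i, TExpr A M (d i)) :
    tOp d h μ (fun i => tmk A M (x i)) = tmk A M (.op d h μ x) :=
  tmk_eq (.op_congr d h μ fun i => rep_tmk (x i))

theorem tmk_update {n : ℕ} {d : Fin n → ℕ} [DecidableEq (Fin n)] (x : ∀ i, TObj A M (d i))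
    (i : Fin n) (y : TExpr A M (d i)) :
    Function.update x i (tmk A M y) =
      fun j => tmk A M (Function.update (fun j => (x j).rep) i y j) := by
  funext j
  by_cases hj : j = i
  · subst hj
    simp
  · simp [Function.update_of_ne hj, tmk_rep]

variable (A M) in
/-- The tensor superalgebra of the left `A`-module `M`, with `M` placed in degree one: the
quotient of the free graded `P`-superalgebra on `A ⊕ M` by the two-sided ideal generated by the
relations above. -/
noncomputable def tensorAlg : Operad.SuperAlg.{w, u, max w u v v'} P where
  obj := TObj A M
  op {n} d {e} h :=
    { toFun := fun μ =>
        { toFun := fun x => tOp d h μ x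
          map_update_add' := by
            intro inst x i y z
            have hinst : inst = instDecidableEqFin _ := Subsingleton.elim _ _
            subst hinst
            induction y using tind
            induction z using tind
            rw [← tmk_add]
            simp only [tmk_update, tOp_tmk]
            exact tmk_eq (.op_add_arg d h μ _ i _ _)
          map_update_smul' := by
            intro inst x i c y
            have hinst : inst = instDecidableEqFin _ := Subsingleton.elim _ _
            subst hinst
            induction y using tind
            rw [← tmk_smul]
            simp only [tmk_update, tOp_tmk]
            exact tmk_eq (.op_smul_arg d h μ _ i c _) }
      map_add' := fun μ μ' => by
        ext x
        exact tmk_eq (.op_add_left d h μ μ' _)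
      map_smul' := fun c μ => by
        ext x
        exact tmk_eq (.op_smul_left d h c μ _) }
  op_perm {n} σ d {e} h h' μ x := tmk_eq (.op_perm σ d h h' μ _)
  op_one {e} h x := (tmk_eq (.op_one h _)).trans (tmk_rep (x 0))
  op_comp {n} {m} d c {e} hc h h' μ ν x := by
    refine (tmk_eq (.op_comp d c hc h h' μ ν _)).trans ?_
    exact (tOp_tmk c h' μ _).symm

variable (A)

/-- The graded `P`-superalgebra of noncommutative differential forms of `A`, the tensor
superalgebra of the module of Kähler differentials. -/
noncomputable def Omega : Operad.SuperAlg.{w, u, max w u v} P := tensorAlg A (Kahler A)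

/-- The inclusion of `A` as the degree zero part. -/
noncomputable def Omega.ofA (a : A.carrier) : (Omega A).obj 0 := tmk A (Kahler A) (.ofA a)

/-- The inclusion of the Kähler differentials as the degree one part. -/
noncomputable def Omega.ofKahler (m : Kahler A) : (Omega A).obj 1 := tmk A (Kahler A) (.ofM m)

variable {A}

/-- `F` is the morphism induced by the morphism `φ` of `P`-algebras: `a ↦ φ(a)`,
`da ↦ d(φ(a))`. -/
def Omega.IsInduced {B : Operad.Alg.{w, u, v} P} (φ : A.Hom B) (F : (Omega A).Hom (Omega B)) :
    Prop :=
  (∀ a, F.app 0 (Omega.ofA A a) = Omega.ofA B (φ.toFun a)) ∧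
  ∀ a, F.app 1 (Omega.ofKahler A (kahlerD A a)) = Omega.ofKahler B (kahlerD B (φ.toFun a))

end Envelope

end

end PGeom

namespace PGeom

variable {k : Type w} [Field k]

/-! ### Relabelling and partial compositions -/

namespace Operad

variable (P : Operad.{w, u} k)

/-! An odd derivation `δ` of a superalgebra `X` is the same thing as a morphism `x ↦ x + ε δx` from
`X` to the dual numbers `X[ε]` with `ε` of degree `-1`. So the differential on the forms need not be
built by hand. It comes from a universal property of `Omega A`, applied with target `(Omega A)[ε]`.

That property (`Omega.exists_lift`) says: linear maps `a ↦ ρ a`, `da ↦ δ a` extend to a morphism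
once `ρ` respects binary operations and `δ` satisfies the binary Leibniz rule over `ρ`. It joins the
universal properties of the Kähler module and of the tensor superalgebra. The enveloping algebra is
made to act on the degree zero part of `Y[ε]`, the square-zero extension of `Y₀` by `Y₁`. In the
other direction, `a` and `da` generate `Omega A` (`Omega.mem_of_generators`), because the enveloping
algebra is generated by the elements `u(μ, a)` (`adjoin_envU`). This is where generation of `P` by
`P(2)` is needed, in the form that inserting binary operations one at a time reaches all of `P`.

For the differential take `a ↦ a + ε da` and `da ↦ da`. In the Leibniz relation the two `ε`-terms
are `μ(da, db)` and `-μ(da, db)`, so they cancel. The resulting `d` satisfies `d² = 0` on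
generators. In `d²` of an operation the mixed terms cancel in pairs, 2 being invertible, so `d² = 0`
everywhere.

In the differential envelope, `da` must go to `d'(ρ a)`. The Leibniz rule of `d'` makes this
assignment legitimate, and generation makes it unique. Degree zero forms are exactly `A`: the image
of `A` is closed under operations of total degree zero, and `A` concentrated in degree zero is a
target that detects it. Naturality follows by applying the universal property to `A → B → Ω⁰B`. -/

@[simp] theorem map_symm_map {I J : Type} [Finite I] [Finite J] (e : I ≃ J) (μ : P.obj I) :
    P.map e.symm (P.map e μ) = μ := by
  rw [← P.map_trans, Equiv.self_trans_symm, P.map_refl]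

@[simp] theorem map_map_symm {I J : Type} [Finite I] [Finite J] (e : I ≃ J) (μ : P.obj J) :
    P.map e (P.map e.symm μ) = μ := by
  rw [← P.map_trans, Equiv.symm_trans_self, P.map_refl]

/-- Relabelling every inner operation of a composite relabels the composite. -/
theorem exists_comp_eq_map {I : Type} [Finite I] {J J' : I → Type} [∀ i, Finite (J i)]
    [∀ i, Finite (J' i)] (μ : P.obj I) (ν : ∀ i, P.obj (J i)) (ν' : ∀ i, P.obj (J' i))
    (h : ∀ i, ∃ f : J i ≃ J' i, P.map f (ν i) = ν' i) :
    ∃ e : (Σ i, J i) ≃ Σ i, J' i, P.comp μ ν' = P.map e (P.comp μ ν) := by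
  choose f hf using h
  obtain rfl : (fun i => P.map (f i) (ν i)) = ν' := funext hf
  exact ⟨_, P.comp_map_right f μ ν⟩

/-- Only the existence of a relabelling is recorded here and below: the generation arguments test
membership in families stable under all bijections, so the bijection itself is irrelevant. -/
theorem exists_map_one_comp {J : Type} [Finite J] (ν : P.obj J) :
    ∃ f : (Σ _ : Unit, J) ≃ J, P.map f (P.comp P.one fun _ : Unit => ν) = ν :=
  ⟨Equiv.uniqueSigma (fun _ : Unit => J), by rw [P.one_comp, P.map_map_symm]⟩

theorem exists_map_comp_one {I : Type} [Finite I] (μ : P.obj I) :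
    ∃ f : (Σ _ : I, Unit) ≃ I, P.map f (P.comp μ fun _ : I => P.one) = μ :=
  ⟨Equiv.sigmaUnique I (fun _ => Unit), by rw [P.comp_one, P.map_map_symm]⟩

theorem partialComp_map_right {I J J' : Type} [Finite I] [Finite J] [Finite J']
    (l : P.obj (Option I)) (e : J ≃ J') (μ : P.obj J) :
    P.partialComp l (P.map e μ) =
      P.map ((Equiv.refl I).sumCongr e) (P.partialComp l μ) := by
  let f : ∀ o : Option I, Slot J o ≃ Slot J' o
    | none => e
    | some _ => Equiv.refl Unit
  have hf : P.slotFill (I := I) (P.map e μ) = fun o => P.map (f o) (P.slotFill μ o) := by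
    funext o
    cases o with
    | none => rfl
    | some i => exact (P.map_refl _).symm
  rw [partialComp, partialComp, hf, P.comp_map_right, ← P.map_trans, ← P.map_trans]
  congr 2
  ext ⟨_ | i, j⟩ <;> rfl

theorem partialComp_map_left {I I' J : Type} [Finite I] [Finite I'] [Finite J] (e : I ≃ I')
    (l : P.obj (Option I)) (μ : P.obj J) :
    P.partialComp (P.map e.optionCongr l) μ =
      P.map (e.sumCongr (Equiv.refl J)) (P.partialComp l μ) := by
  let f : ∀ o : Option I, Slot J o ≃ Slot J (e.optionCongr o)
    | none => Equiv.refl J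
    | some _ => Equiv.refl Unit
  have hf : (fun o => P.slotFill μ (e.optionCongr o)) = fun o => P.map (f o) (P.slotFill μ o) := by
    funext o
    cases o <;> exact (P.map_refl _).symm
  rw [partialComp, partialComp, P.comp_map_left, hf, P.comp_map_right, ← P.map_trans,
    ← P.map_trans, ← P.map_trans]
  congr 2
  ext ⟨_ | i, j⟩ <;> rfl

open Classical in
/-- Partial composition as a linear map in the inserted operation. -/
noncomputable def partialCompHom {I J : Type} [Finite I] [Finite J] (l : P.obj (Option I)) :
    P.obj J →ₗ[k] P.obj (I ⊕ J) :=
  P.map (slotEquiv I J) ∘ₗ (P.comp l).toLinearMap (P.slotFill (0 : P.obj J)) none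

theorem partialCompHom_apply {I J : Type} [Finite I] [Finite J] (l : P.obj (Option I))
    (μ : P.obj J) : P.partialCompHom l μ = P.partialComp l μ := by
  classical
  have h : P.slotFill (I := I) μ =
      Function.update (P.slotFill (0 : P.obj J)) none (μ : P.obj (Slot (I := I) J none)) := by
    funext o
    cases o with
    | none => exact (Function.update_self (β := fun o : Option I => P.obj (Slot J o)) _ _ _).symm
    | some i => exact (Function.update_of_ne (β := fun o : Option I => P.obj (Slot J o))
        (Option.some_ne_none i) _ _).symm
  rw [partialComp, h]
  rfl

/-- The index family equal to `J` on the right and to a point on the left. -/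
def SumSlot {K I : Type} (J : I → Type) : K ⊕ I → Type
  | Sum.inl _ => Unit
  | Sum.inr i => J i

instance {K I : Type} (J : I → Type) [∀ i, Finite (J i)] (s : K ⊕ I) : Finite (SumSlot J s) := by
  cases s <;> simp only [SumSlot] <;> infer_instance

/-- The operations `ν i` in the slots on the right, the identity in the slots on the left. -/
def sumFill {K I : Type} {J : I → Type} [∀ i, Finite (J i)] (ν : ∀ i, P.obj (J i)) :
    ∀ s : K ⊕ I, P.obj (SumSlot J s)
  | Sum.inl _ => P.one
  | Sum.inr i => ν i

theorem exists_comp_comp {I : Type} [Finite I] {J : I → Type} [∀ i, Finite (J i)]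
    {K : ∀ i, J i → Type} [∀ i j, Finite (K i j)]
    (μ : P.obj I) (ν : ∀ i, P.obj (J i)) (ξ : ∀ p : Σ i, J i, P.obj (K p.1 p.2)) :
    ∃ e : (Σ i, Σ j, K i j) ≃ (Σ p : Σ i, J i, K p.1 p.2),
      P.comp (P.comp μ ν) ξ = P.map e (P.comp μ fun i => P.comp (ν i) fun j => ξ ⟨i, j⟩) :=
  ⟨(Equiv.sigmaAssoc K).symm, by
    rw [P.comp_assoc μ ν (fun i j => ξ ⟨i, j⟩), P.map_symm_map]⟩

/-! ### Generation by inserting binary operations one at a time -/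

section Generation

variable {P} {S : ∀ (I : Type) [Finite I], Submodule k (P.obj I)}

theorem map_mem_iff (hmap : ∀ {I J : Type} [Finite I] [Finite J] (e : I ≃ J) (μ : P.obj I),
    μ ∈ S I → P.map e μ ∈ S J) {I J : Type} [Finite I] [Finite J] (e : I ≃ J) (μ : P.obj I) :
    P.map e μ ∈ S J ↔ μ ∈ S I :=
  ⟨fun h => by simpa using hmap e.symm _ h, hmap e μ⟩

/-- The slots in `I` are filled one by one, by induction on `I`. The set `K` of idle slots stays
arbitrary because the inputs of an operation already inserted join `K` at the next step. -/
theorem comp_sumFill_mem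
    (hmap : ∀ {I J : Type} [Finite I] [Finite J] (e : I ≃ J) (μ : P.obj I),
      μ ∈ S I → P.map e μ ∈ S J) (I : Type) [Finite I] :
    ∀ (K : Type) [Finite K] (l : P.obj (K ⊕ I)), l ∈ S (K ⊕ I) →
    ∀ (J : I → Type) [∀ i, Finite (J i)] (ν : ∀ i, P.obj (J i)),
      (∀ i (K' : Type) [Finite K'] (l' : P.obj (Option K')), l' ∈ S (Option K') →
        P.partialComp l' (ν i) ∈ S (K' ⊕ J i)) →
      P.comp l (P.sumFill ν) ∈ S (Σ s, SumSlot J s) := by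
  revert ‹Finite I›
  refine Finite.induction_empty_option (P := fun I => ∀ [Finite I] (K : Type) [Finite K]
    (l : P.obj (K ⊕ I)), l ∈ S (K ⊕ I) →
    ∀ (J : I → Type) [∀ i, Finite (J i)] (ν : ∀ i, P.obj (J i)),
      (∀ i (K' : Type) [Finite K'] (l' : P.obj (Option K')), l' ∈ S (Option K') →
        P.partialComp l' (ν i) ∈ S (K' ⊕ J i)) →
      P.comp l (P.sumFill ν) ∈ S (Σ s, SumSlot J s)) ?_ ?_ ?_ I
  · intro α β e ih _ K _ l hl J _ ν hν
    have : Finite α := Finite.of_equiv β e.symm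
    let g : K ⊕ α ≃ K ⊕ β := (Equiv.refl K).sumCongr e
    have h := ih K (P.map g.symm l) (hmap _ _ hl) (fun a => J (e a)) (fun a => ν (e a))
      (fun a => hν (e a))
    rw [← P.map_map_symm g l, P.comp_map_left, map_mem_iff hmap]
    obtain ⟨f, hf⟩ := P.exists_comp_eq_map (P.map g.symm l) (P.sumFill fun a => ν (e a))
      (fun s => P.sumFill ν (g s)) (by
        rintro (s | s)
        · exact ⟨Equiv.refl Unit, P.map_refl _⟩
        · exact ⟨Equiv.refl (J (e s)), P.map_refl _⟩)
    rw [hf]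
    exact hmap _ _ h
  · intro _ K _ l hl J _ ν hν
    obtain ⟨f, hf⟩ := P.exists_comp_eq_map l (fun _ => P.one)
      (P.sumFill ν) (by
        rintro (s | s)
        · exact ⟨Equiv.refl Unit, P.map_refl _⟩
        · exact s.elim)
    rw [hf, map_mem_iff hmap, P.comp_one]
    exact hmap _ _ hl
  · intro α _ ih _ K _ l hl J _ ν hν
    -- `g` exposes the slot to be filled first; `h` then declares the new inputs `J none` idle.
    let g : Option (K ⊕ α) ≃ K ⊕ Option α :=
      { toFun := fun o => o.elim (Sum.inr none) (Sum.map id some)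
        invFun := Sum.elim (fun x => some (Sum.inl x)) (Option.map Sum.inr)
        left_inv := by rintro (_ | x | x) <;> rfl
        right_inv := by rintro (x | _ | x) <;> rfl }
    let h : (K ⊕ α) ⊕ J none ≃ (K ⊕ J none) ⊕ α :=
      { toFun := Sum.elim (Sum.elim (fun x => Sum.inl (Sum.inl x)) Sum.inr)
          (fun x => Sum.inl (Sum.inr x))
        invFun := Sum.elim (Sum.elim (fun x => Sum.inl (Sum.inl x)) Sum.inr)
          (fun x => Sum.inl (Sum.inr x))
        left_inv := by rintro ((x | x) | x) <;> rfl
        right_inv := by rintro ((x | x) | x) <;> rfl }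
    have h1 := hν none _ (P.map g.symm l) (hmap _ _ hl)
    have h2 := ih (K ⊕ J none) (P.map h (P.partialComp (P.map g.symm l) (ν none))) (hmap _ _ h1)
      (fun a => J (some a)) (fun a => ν (some a)) (fun a => hν (some a))
    rw [P.comp_map_left, map_mem_iff hmap, partialComp, P.comp_map_left, map_mem_iff hmap] at h2
    -- By associativity the two-stage filling is one composite whose inner operations are `ν none`
    -- followed by identities, or an identity followed by `one` or `ν (some s)`. The unit laws turn
    -- these into the entries of `sumFill ν`.
    obtain ⟨f, hf⟩ := P.exists_comp_comp (P.map g.symm l) (P.slotFill (ν none))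
      (K := fun o j => SumSlot (fun a => J (some a)) (h (slotEquiv (K ⊕ α) (J none) ⟨o, j⟩)))
      (fun p => P.sumFill (fun a => ν (some a)) (h (slotEquiv (K ⊕ α) (J none) p)))
    have h3 := hf ▸ h2
    rw [map_mem_iff hmap] at h3
    obtain ⟨f', hf'⟩ := P.exists_comp_eq_map (P.map g.symm l) (fun o => P.comp
        (P.slotFill (ν none) o) fun j => P.sumFill (fun a => ν (some a))
          (h (slotEquiv (K ⊕ α) (J none) ⟨o, j⟩)))
      (fun o => P.sumFill ν (g o)) (by
        rintro (_ | s | s)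
        · exact P.exists_map_comp_one (ν none)
        · exact P.exists_map_one_comp P.one
        · exact P.exists_map_one_comp (ν (some s)))
    rw [← P.map_map_symm g l, P.comp_map_left, map_mem_iff hmap, hf']
    exact hmap _ _ h3

/-- Inserting a composite into a slot is, up to relabelling, inserting the outer operation and
then composing with the inner ones. -/
theorem exists_partialComp_comp {K I : Type} [Finite K] [Finite I] {J : I → Type}
    [∀ i, Finite (J i)] (l : P.obj (Option K)) (μ : P.obj I) (ν : ∀ i, P.obj (J i)) :
    ∃ e : (Σ s, SumSlot J s) ≃ K ⊕ (Σ i, J i), P.partialComp l (P.comp μ ν) =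
      P.map e (P.comp (P.partialComp l μ) (P.sumFill ν)) := by
  obtain ⟨f, hf⟩ := P.exists_comp_comp l (P.slotFill μ)
      (K := fun o j => SumSlot J (slotEquiv K I ⟨o, j⟩))
      (fun p => P.sumFill ν (slotEquiv K I p))
  obtain ⟨f', hf'⟩ := P.exists_comp_eq_map l (fun o => P.comp
        (P.slotFill μ o) fun j => P.sumFill ν (slotEquiv K I ⟨o, j⟩))
      (P.slotFill (P.comp μ ν)) (by
        rintro (_ | s)
        · exact ⟨Equiv.refl (Σ i, J i), P.map_refl _⟩
        · exact P.exists_map_one_comp P.one)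
  refine ⟨((Equiv.sigmaCongrLeft (slotEquiv K I)).symm.trans f.symm).trans
    (f'.trans (slotEquiv K (Σ i, J i))), ?_⟩
  rw [partialComp, partialComp, hf', P.comp_map_left]
  rw [P.map_trans, P.map_trans, P.map_trans _ f.symm, P.map_symm_map]
  congr 2
  exact (P.map_symm_map f _).symm.trans (congrArg (P.map f.symm) hf.symm)

/-- An operad generated by its binary operations is generated by inserting binary operations
one at a time. -/
theorem IsBinaryGenerated.mem_of_partialComp (hP : P.IsBinaryGenerated)
    (hmap : ∀ {I J : Type} [Finite I] [Finite J] (e : I ≃ J) (μ : P.obj I),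
      μ ∈ S I → P.map e μ ∈ S J) (hone : P.one ∈ S Unit)
    (hcomp : ∀ {I : Type} [Finite I] (l : P.obj (Option I)) (β : P.obj (Fin 2)),
      l ∈ S (Option I) → P.partialComp l β ∈ S (I ⊕ Fin 2))
    {I : Type} [Finite I] (μ : P.obj I) : μ ∈ S I := by
  -- `S` itself is not visibly closed under full composition. The operations whose insertion into
  -- members of `S` stays in `S` do form a suboperad: a composite is inserted by inserting its outer
  -- operation and then the inner ones, slot by slot.
  let G : ∀ (I : Type) [Finite I], Submodule k (P.obj I) := fun I _ =>
    { carrier := {μ | ∀ (K : Type) [Finite K] (l : P.obj (Option K)), l ∈ S (Option K) →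
        P.partialComp l μ ∈ S (K ⊕ I)}
      add_mem' := fun {a b} ha hb K _ l hl => by
        rw [← partialCompHom_apply, map_add, partialCompHom_apply, partialCompHom_apply]
        exact add_mem (ha K l hl) (hb K l hl)
      zero_mem' := fun K _ l hl => by
        rw [← partialCompHom_apply, map_zero]
        exact zero_mem _
      smul_mem' := fun c a ha K _ l hl => by
        rw [← partialCompHom_apply, map_smul, partialCompHom_apply]
        exact Submodule.smul_mem _ _ (ha K l hl) }
  have h1 : ∀ {I : Type} [Finite I] (l : P.obj (Option I)), l ∈ S (Option I) →
      P.partialComp l P.one ∈ S (I ⊕ Unit) := by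
    intro I _ l hl
    obtain ⟨f, hf⟩ := P.exists_comp_eq_map l (fun _ => P.one)
      (P.slotFill P.one) (by
        rintro (_ | s)
        · exact ⟨Equiv.refl Unit, P.map_refl _⟩
        · exact ⟨Equiv.refl Unit, P.map_refl _⟩)
    rw [partialComp, map_mem_iff hmap, hf, map_mem_iff hmap, P.comp_one]
    exact hmap _ _ hl
  have hG : ∀ (I : Type) [Finite I] (μ : P.obj I), μ ∈ G I := by
    refine hP G ?_ ?_ ?_ ?_
    · intro I J _ _ e μ hμ K _ l hl
      rw [partialComp_map_right]
      exact hmap _ _ (hμ K l hl)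
    · intro K _ l hl
      exact h1 l hl
    · intro I _ J _ μ ν hμ hν K _ l hl
      obtain ⟨e, he⟩ := exists_partialComp_comp l μ ν
      rw [he]
      exact hmap _ _ (comp_sumFill_mem hmap I K _ (hμ K l hl) J ν fun i K' _ => hν i K')
    · intro μ K _ l hl
      exact hcomp l μ hl
  -- Every `μ` now lies in `G`. Inserting it into the only slot of the identity operation returns
  -- `μ` up to relabelling.
  let e : Unit ≃ Option Empty := Equiv.ofUnique _ _
  have h := hG I μ Empty (P.map e P.one) (hmap _ _ hone)
  obtain ⟨f, hf⟩ := P.exists_map_one_comp μ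
  obtain ⟨f', hf'⟩ := P.exists_comp_eq_map P.one (fun _ => μ)
    (fun u => P.slotFill (I := Empty) μ (e u)) (fun u => ⟨Equiv.refl I, P.map_refl _⟩)
  rw [partialComp, map_mem_iff hmap, P.comp_map_left, map_mem_iff hmap, hf',
    map_mem_iff hmap] at h
  rw [← hf]
  exact hmap _ _ h

end Generation

end Operad

/-! ### Operations on families with arbitrary finite index sets -/

namespace Operad.Alg

variable {P : Operad.{w, u} k} (A : Operad.Alg.{w, u, v} P)

/-- The operation on families indexed by a finite set `I` defined by an element of `P(I)`. -/
noncomputable def opI {I : Type} [Finite I] :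
    P.obj I →ₗ[k] MultilinearMap k (fun _ : I => A.carrier) A.carrier :=
  (MultilinearMap.domDomCongrLinearEquiv k k A.carrier A.carrier
    (Finite.equivFin I).symm).toLinearMap ∘ₗ A.op ∘ₗ P.map (Finite.equivFin I)

/-- Two numberings of `I` differ by a permutation, which `op_perm` absorbs, so the numbering chosen
in `opI` does not matter. -/
theorem opI_eq {I : Type} [Finite I] {n : ℕ} (e : I ≃ Fin n) (μ : P.obj I) (x : I → A.carrier) :
    A.opI μ x = A.op (P.map e μ) fun i => x (e.symm i) := by
  obtain rfl : n = Nat.card I := by simp [Nat.card_congr e]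
  have h : P.map (Finite.equivFin I) μ =
      P.map (e.symm.trans (Finite.equivFin I)) (P.map e μ) := by
    rw [← P.map_trans]
    congr 2
    ext
    simp
  change A.op (P.map (Finite.equivFin I) μ) (fun i => x ((Finite.equivFin I).symm i)) = _
  rw [h, A.op_perm]
  simp

theorem opI_fin {n : ℕ} (μ : P.obj (Fin n)) (x : Fin n → A.carrier) : A.opI μ x = A.op μ x := by
  rw [A.opI_eq (Equiv.refl _), P.map_refl]
  rfl

theorem opI_map {I J : Type} [Finite I] [Finite J] (f : I ≃ J) (μ : P.obj I)
    (x : J → A.carrier) : A.opI (P.map f μ) x = A.opI μ fun i => x (f i) := by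
  let e := Finite.equivFin J
  rw [A.opI_eq e, A.opI_eq (f.trans e), P.map_trans]
  simp

theorem opI_one (x : Unit → A.carrier) : A.opI P.one x = x () := by
  rw [A.opI_eq (Equiv.ofUnique Unit (Fin 1))]
  exact A.op_one _

theorem opI_comp {I : Type} [Finite I] {J : I → Type} [∀ i, Finite (J i)] (μ : P.obj I)
    (ν : ∀ i, P.obj (J i)) (x : (Σ i, J i) → A.carrier) :
    A.opI (P.comp μ ν) x = A.opI μ fun i => A.opI (ν i) fun j => x ⟨i, j⟩ := by
  let e := Finite.equivFin I
  let f : ∀ n : Fin (Nat.card I), J (e.symm n) ≃ Fin (Nat.card (J (e.symm n))) :=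
    fun n => Finite.equivFin _
  have hν : (fun n => ν (e.symm n)) = fun n => P.map (f n).symm (P.map (f n) (ν (e.symm n))) := by
    simp
  conv_lhs => rw [← P.map_symm_map e μ]
  rw [P.comp_map_left, A.opI_map, hν, P.comp_map_right, A.opI_map, A.opI_eq finSigmaFinEquiv,
    A.op_comp, A.opI_eq e μ]
  congr 1
  funext n
  rw [A.opI_eq (f n)]
  simp only [Equiv.symm_apply_apply]
  rfl

theorem opI_partialComp {I J : Type} [Finite I] [Finite J] (l : P.obj (Option I)) (μ : P.obj J)
    (x : I ⊕ J → A.carrier) : A.opI (P.partialComp l μ) x =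
      A.opI l fun o => o.elim (A.opI μ fun j => x (Sum.inr j)) fun i => x (Sum.inl i) := by
  rw [Operad.partialComp, A.opI_map, A.opI_comp]
  congr 1
  funext o
  cases o with
  | none => rfl
  | some i => exact A.opI_one _

theorem op_compLast {n m : ℕ} (l : P.obj (Fin (n + 1))) (μ : P.obj (Fin m))
    (x : Fin (n + m) → A.carrier) : A.op (P.compLast l μ) x =
      A.op l (Fin.snoc (α := fun _ => A.carrier) (fun i => x (Fin.castAdd m i))
        (A.op μ fun j => x (Fin.natAdd n j))) := by
  rw [← A.opI_fin, Operad.compLast, A.opI_map, A.opI_partialComp, A.opI_map, A.opI_fin, A.opI_fin]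
  congr 1
  funext i
  induction i using Fin.lastCases <;> simp

theorem op_compFirst {n m : ℕ} (l : P.obj (Fin (n + 1))) (μ : P.obj (Fin m))
    (x : Fin (m + n) → A.carrier) : A.op (P.compFirst l μ) x =
      A.op l (Fin.cons (α := fun _ => A.carrier) (A.op μ fun j => x (Fin.castAdd n j))
        fun i => x (Fin.natAdd m i)) := by
  rw [← A.opI_fin, Operad.compFirst, A.opI_map, A.opI_partialComp, A.opI_map, A.opI_fin, A.opI_fin]
  congr 1
  funext i
  induction i using Fin.cases <;> simp

/-- If `P` is generated by its binary operations, then a linear map that respects the binary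
operations is a morphism of algebras. -/
theorem map_op_of_binary {A : Operad.Alg.{w, u, v} P} {B : Operad.Alg.{w, u, v'} P}
    (hP : P.IsBinaryGenerated) (f : A.carrier →ₗ[k] B.carrier)
    (hf : ∀ (μ : P.obj (Fin 2)) (a b : A.carrier), f (A.op μ ![a, b]) = B.op μ ![f a, f b])
    {n : ℕ} (μ : P.obj (Fin n)) (x : Fin n → A.carrier) :
    f (A.op μ x) = B.op μ fun i => f (x i) := by
  -- The operations that commute with `f` form a suboperad.
  let S : ∀ (I : Type) [Finite I], Submodule k (P.obj I) := fun I _ =>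
    { carrier := {μ | ∀ x : I → A.carrier, f (A.opI μ x) = B.opI μ fun i => f (x i)}
      add_mem' := fun {a b} ha hb x => by
        simp only [map_add, add_apply, ha x, hb x]
      zero_mem' := fun x => by simp
      smul_mem' := fun c a ha x => by
        simp only [map_smul, smul_apply, ha x] }
  have h := hP S
    (fun e μ hμ x => by rw [A.opI_map, B.opI_map, hμ])
    (fun x => by rw [A.opI_one, B.opI_one])
    (fun μ ν hμ hν x => by
      rw [A.opI_comp, B.opI_comp, hμ]
      congr 1
      funext i
      exact hν i _)
    (fun μ x => by
      rw [A.opI_fin, B.opI_fin]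
      convert hf μ (x 0) (x 1) using 2
      · congr 1
        funext i
        fin_cases i <;> rfl
      · funext i
        fin_cases i <;> rfl)
    (Fin n) μ x
  rwa [A.opI_fin, B.opI_fin] at h

/-- The morphism of algebras with a given underlying linear map that respects the binary
operations. -/
def Hom.ofBinary {A : Operad.Alg.{w, u, v} P} {B : Operad.Alg.{w, u, v'} P}
    (hP : P.IsBinaryGenerated) (f : A.carrier →ₗ[k] B.carrier)
    (hf : ∀ (μ : P.obj (Fin 2)) (a b : A.carrier), f (A.op μ ![a, b]) = B.op μ ![f a, f b]) :
    A.Hom B :=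
  ⟨f, map_op_of_binary hP f hf⟩

end Operad.Alg

/-! ### Signs -/

/-- The sign of moving an odd operator past the entries of degrees `d j` with `j < i`. -/
def leibnizSign (k : Type w) [Field k] {n : ℕ} (d : Fin n → ℕ) (i : Fin n) : k :=
  (-1) ^ ∑ j ∈ Finset.univ.filter (· < i), d j

theorem bumpDeg_eq {n : ℕ} (d : Fin n → ℕ) (i j : Fin n) :
    bumpDeg d i j = d j + if j = i then 1 else 0 := by
  by_cases h : j = i <;> simp [bumpDeg, h]

theorem leibnizSign_eq_prod {n : ℕ} (d : Fin n → ℕ) (i : Fin n) :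
    leibnizSign k d i = ∏ j, if j < i then (-1 : k) ^ d j else 1 := by
  rw [leibnizSign, ← Finset.prod_pow_eq_pow_sum, Finset.prod_filter]

/-- The two Leibniz signs range over the `b` with `σ b < σ i` and with `b < i`. These sets differ
exactly in the `b` inverted with `i`, and those are the pairs whose Koszul factor changes when the
degree at `σ i` is raised. -/
theorem koszulSign_bumpDeg {n : ℕ} (σ : Equiv.Perm (Fin n)) (d : Fin n → ℕ) (i : Fin n) :
    leibnizSign k d (σ i) * koszulSign k σ (bumpDeg d (σ i)) =
      koszulSign k σ d * leibnizSign k (fun j => d (σ j)) i := by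
  have h1 : koszulSign k σ (bumpDeg d (σ i)) = koszulSign k σ d *
      ((∏ b, if i < b ∧ σ b < σ i then (-1 : k) ^ d (σ b) else 1) *
        ∏ a, if a < i ∧ σ i < σ a then (-1 : k) ^ d (σ a) else 1) := by
    -- Both correction factors are spread over all pairs `(a, b)`, so that the identity can be
    -- checked pair by pair.
    have e1 : (∏ b, if i < b ∧ σ b < σ i then (-1 : k) ^ d (σ b) else 1) =
        ∏ a, ∏ b, if a = i then (if i < b ∧ σ b < σ i then (-1 : k) ^ d (σ b) else 1) else 1 := by
      rw [Finset.prod_comm]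
      simp
    have e2 : (∏ a, if a < i ∧ σ i < σ a then (-1 : k) ^ d (σ a) else 1) =
        ∏ a, ∏ b, if b = i then (if a < i ∧ σ i < σ a then (-1 : k) ^ d (σ a) else 1) else 1 := by
      simp
    rw [e1, e2, koszulSign, koszulSign, ← Finset.prod_mul_distrib, ← Finset.prod_mul_distrib]
    refine Finset.prod_congr rfl fun a _ => ?_
    rw [← Finset.prod_mul_distrib, ← Finset.prod_mul_distrib]
    refine Finset.prod_congr rfl fun b _ => ?_
    simp only [bumpDeg_eq, EmbeddingLike.apply_eq_iff_eq]
    by_cases hab : a < b ∧ σ b < σ a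
    · have hne : a ≠ b := hab.1.ne
      by_cases ha : a = i
      · subst ha
        simp [hab, hne.symm, add_mul, pow_add]
      · by_cases hb : b = i
        · subst hb
          simp [hab, hne, mul_add, pow_add]
        · simp [hab, ha, hb]
    · rw [if_neg hab, if_neg hab]
      have ha : a = i → ¬ (i < b ∧ σ b < σ i) := fun h => h ▸ hab
      have hb : b = i → ¬ (a < i ∧ σ i < σ a) := fun h => h ▸ hab
      by_cases h : a = i <;> by_cases h' : b = i <;> simp_all
  have h2 : leibnizSign k d (σ i) = ∏ b, if σ b < σ i then (-1 : k) ^ d (σ b) else 1 := by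
    rw [leibnizSign_eq_prod]
    exact (Equiv.prod_comp σ fun b => if b < σ i then (-1 : k) ^ d b else 1).symm
  rw [h1, h2, leibnizSign_eq_prod, mul_left_comm, ← Finset.prod_mul_distrib,
    ← Finset.prod_mul_distrib]
  congr 1
  refine Finset.prod_congr rfl fun b _ => ?_
  have hsq : (-1 : k) ^ d (σ b) * (-1) ^ d (σ b) = 1 := by
    rw [← mul_pow]
    simp
  rcases lt_trichotomy b i with h | rfl | h
  · rcases lt_or_gt_of_ne (σ.injective.ne h.ne) with h' | h'
    · simp [h, h', h.not_gt, h'.not_gt]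
    · simp [h, h', h.not_gt, h'.not_gt]
  · simp
  · rcases lt_or_gt_of_ne (σ.injective.ne h.ne') with h' | h'
    · simp [h, h', h.not_gt, h'.not_gt, hsq]
    · simp [h, h', h.not_gt, h'.not_gt]

/-- The numbering of the dependent sum is lexicographic: the position of `p` is the total size of
the earlier blocks plus its place inside its own block. -/
theorem finSigmaFinEquiv_lt_iff {n : ℕ} {m : Fin n → ℕ} (p q : Σ i, Fin (m i)) :
    finSigmaFinEquiv p < finSigmaFinEquiv q ↔
      p.1 < q.1 ∨ ∃ _h : p.1 = q.1, (p.2 : ℕ) < q.2 := by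
  have key : ∀ p q : Σ i, Fin (m i), p.1 < q.1 → finSigmaFinEquiv p < finSigmaFinEquiv q := by
    intro p q h
    rw [Fin.lt_def, finSigmaFinEquiv_apply, finSigmaFinEquiv_apply]
    let g : ℕ → ℕ := fun t => if ht : t < n then m ⟨t, ht⟩ else 0
    have hg : ∀ r : Fin n, ∑ i : Fin r, m (Fin.castLE r.2.le i) = ∑ t ∈ Finset.range r, g t := by
      intro r
      rw [← Fin.sum_univ_eq_sum_range]
      refine Finset.sum_congr rfl fun t _ => ?_
      have : (t : ℕ) < n := t.2.trans r.2
      simp only [g, this, dif_pos]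
      rfl
    rw [hg, hg]
    have h1 : ∑ t ∈ Finset.range p.1, g t + p.2 < ∑ t ∈ Finset.range (p.1 + 1), g t := by
      rw [Finset.sum_range_succ]
      simp [g]
    have h2 : ∑ t ∈ Finset.range (p.1 + 1), g t ≤ ∑ t ∈ Finset.range q.1, g t :=
      Finset.sum_le_sum_of_subset (Finset.range_mono h)
    omega
  rcases lt_trichotomy p.1 q.1 with h | h | h
  · simp [h, key p q h]
  · obtain ⟨i, j⟩ := p
    obtain ⟨i', j'⟩ := q
    obtain rfl : i = i' := h
    rw [Fin.lt_def, finSigmaFinEquiv_apply, finSigmaFinEquiv_apply]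
    simp
  · have h' := key q p h
    simp [h.ne', h.not_gt, h'.not_gt]

/-- The entries before `(i, j)` are the full blocks before `i`, of degrees `c`, and the earlier
entries of block `i`. This gives associativity of composition in the dual numbers. -/
theorem leibnizSign_sigma {n : ℕ} {m : Fin n → ℕ} (d : Fin (∑ i, m i) → ℕ) (c : Fin n → ℕ)
    (hc : ∀ i, ∑ j, d (finSigmaFinEquiv ⟨i, j⟩) = c i) (i : Fin n) (j : Fin (m i)) :
    leibnizSign k d (finSigmaFinEquiv ⟨i, j⟩) =
      leibnizSign k c i * leibnizSign k (fun j => d (finSigmaFinEquiv ⟨i, j⟩)) j := by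
  rw [leibnizSign, leibnizSign, leibnizSign, ← pow_add]
  congr 1
  rw [Finset.sum_filter, ← finSigmaFinEquiv.sum_comp, Fintype.sum_sigma, Finset.sum_filter,
    Finset.sum_filter]
  simp only [finSigmaFinEquiv_lt_iff]
  have h : ∀ i', (∑ j' : Fin (m i'), if i' < i ∨ ∃ _h : i' = i, (j' : ℕ) < j then
      d (finSigmaFinEquiv ⟨i', j'⟩) else 0) = (if i' < i then c i' else 0) +
        if i' = i then ∑ j', (if j' < j then d (finSigmaFinEquiv ⟨i, j'⟩) else 0) else 0 := by
    intro i'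
    by_cases h1 : i' = i
    · subst h1
      simp
    · simp only [h1, IsEmpty.exists_iff, or_false, if_false, add_zero]
      split_ifs
      · exact hc i'
      · simp
  rw [Finset.sum_congr rfl fun i' _ => h i', Finset.sum_add_distrib, Finset.sum_ite_eq']
  simp

/-! ### Dual numbers over a superalgebra -/

/-- The first or the second entry of a pair of elements of adjacent degrees. -/
def selectEntry {X : ℕ → Type v} [∀ i, AddCommGroup (X i)] [∀ i, Module k (X i)] (a : ℕ) :
    ∀ b : Bool, X a × X (a + 1) →ₗ[k] X (cond b (a + 1) a)
  | true => LinearMap.snd k _ _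
  | false => LinearMap.fst k _ _

/-- The second entry of a pair in position `i`, the first entry in all other positions. -/
def pickAt {X : ℕ → Type v} [∀ i, AddCommGroup (X i)] [∀ i, Module k (X i)] {n : ℕ}
    (d : Fin n → ℕ) (i j : Fin n) : X (d j) × X (d j + 1) →ₗ[k] X (bumpDeg d i j) :=
  selectEntry (d j) (decide (j = i))

section

variable {X : ℕ → Type v} [∀ i, AddCommGroup (X i)] [∀ i, Module k (X i)] {n m : ℕ}

theorem pickAt_heq_snd (d : Fin n → ℕ) {i j : Fin n} (h : j = i) (z : X (d j) × X (d j + 1)) :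
    pickAt (k := k) d i j z ≍ z.2 := by
  -- The type `X (bumpDeg d i j)` reduces only when the Boolean `decide (j = i)` is known, so the
  -- Boolean is generalised first.
  have key : ∀ b : Bool, b = true → selectEntry (k := k) (d j) b z ≍ z.2 := by
    rintro _ rfl
    rfl
  exact key _ (by simp [h])

theorem pickAt_heq_fst (d : Fin n → ℕ) {i j : Fin n} (h : j ≠ i) (z : X (d j) × X (d j + 1)) :
    pickAt (k := k) d i j z ≍ z.1 := by
  have key : ∀ b : Bool, b = false → selectEntry (k := k) (d j) b z ≍ z.1 := by
    rintro _ rfl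
    rfl
  exact key _ (by simp [h])

end

namespace Operad.SuperAlg

variable {P : Operad.{w, u} k} (X : Operad.SuperAlg.{w, u, v} P)

/-- Raised degrees reached along different routes agree only propositionally; this compares
operations across such equalities. -/
theorem op_heq {n : ℕ} {d d' : Fin n → ℕ} {e e' : ℕ} (h : ∑ i, d i = e) (h' : ∑ i, d' i = e')
    (he : e = e') (hd : ∀ i, d i = d' i) (μ : P.obj (Fin n)) (x : ∀ i, X.obj (d i))
    (x' : ∀ i, X.obj (d' i)) (hx : ∀ i, x i ≍ x' i) : X.op d h μ x ≍ X.op d' h' μ x' := by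
  obtain rfl : d = d' := funext hd
  obtain rfl : x = x' := funext fun i => eq_of_heq (hx i)
  subst he
  rfl

theorem op_congr {n : ℕ} {d d' : Fin n → ℕ} {e : ℕ} (h : ∑ i, d i = e) (h' : ∑ i, d' i = e)
    (hd : ∀ i, d i = d' i) (μ : P.obj (Fin n)) (x : ∀ i, X.obj (d i))
    (x' : ∀ i, X.obj (d' i)) (hx : ∀ i, x i ≍ x' i) : X.op d h μ x = X.op d' h' μ x' :=
  eq_of_heq (X.op_heq h h' rfl hd μ x x' hx)

/-- The operation on pairs that applies `μ` to the second entry in position `i` and to the first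
entries elsewhere. -/
def opBump {n : ℕ} (d : Fin n → ℕ) {e : ℕ} (h : ∑ i, d i = e) (μ : P.obj (Fin n)) (i : Fin n) :
    MultilinearMap k (fun j => X.obj (d j) × X.obj (d j + 1)) (X.obj (e + 1)) :=
  (X.op (bumpDeg d i) (sum_bumpDeg d h i) μ).compLinearMap (pickAt d i)

theorem opBump_apply {n : ℕ} (d : Fin n → ℕ) {e : ℕ} (h : ∑ i, d i = e) (μ : P.obj (Fin n))
    (i : Fin n) (z : ∀ j, X.obj (d j) × X.obj (d j + 1)) :
    X.opBump d h μ i z = X.op (bumpDeg d i) (sum_bumpDeg d h i) μ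
      fun j => pickAt (k := k) d i j (z j) := rfl

/-- `opBump` depends on the second entry in position `i` only, and linearly so. -/
theorem opBump_sum {n : ℕ} (d : Fin n → ℕ) {e : ℕ} (h : ∑ i, d i = e) (μ : P.obj (Fin n))
    (i : Fin n) (x : ∀ j, X.obj (d j)) (y : ∀ j, X.obj (d j + 1)) {T : Type} [Fintype T]
    (c : T → k) (t : T → X.obj (d i + 1)) (hy : y i = ∑ s, c s • t s) :
    X.opBump d h μ i (fun j => (x j, y j)) =
      ∑ s, c s • X.opBump d h μ i fun j => (x j, Function.update y i (t s) j) := by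
  have key : ∀ r : X.obj (d i + 1),
      X.opBump d h μ i (fun j => (x j, Function.update y i r j)) =
        (X.op (bumpDeg d i) (sum_bumpDeg d h i) μ).toLinearMap
          (fun j => pickAt (k := k) d i j (x j, y j)) i
          (pickAt (k := k) d i i (LinearMap.inr k _ _ r)) := by
    intro r
    rw [opBump_apply, MultilinearMap.toLinearMap_apply]
    congr 1
    funext j
    by_cases hj : j = i
    · subst hj
      rw [Function.update_self, Function.update_self]
      exact eq_of_heq ((pickAt_heq_snd d rfl _).trans
        (pickAt_heq_snd d rfl (LinearMap.inr k _ _ r)).symm)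
    · rw [Function.update_of_ne hj, Function.update_of_ne hj]
  have h0 := key (y i)
  rw [Function.update_eq_self] at h0
  rw [h0, hy]
  simp only [map_sum, map_smul, key]

/-- The superalgebra `X[ε]` of dual numbers over `X`, with `ε` of degree `-1`: in degree `e` it
consists of the elements `x + ε y` with `x` of degree `e` and `y` of degree `e + 1`. -/
def eps : Operad.SuperAlg.{w, u, v} P where
  obj e := X.obj e × X.obj (e + 1)
  op {n} d {e} h :=
    { toFun := fun μ =>
        ((X.op d h μ).compLinearMap fun _ => LinearMap.fst k _ _).prod
          (∑ i, leibnizSign k d i • X.opBump d h μ i)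
      map_add' := fun μ μ' => by
        ext z
        · simp
        · simp only [MultilinearMap.prod_apply, sum_apply, smul_apply, opBump_apply, map_add,
            add_apply, Prod.snd_add, smul_add, Finset.sum_add_distrib]
      map_smul' := fun c μ => by
        ext z
        · simp
        · simp only [MultilinearMap.prod_apply, sum_apply, smul_apply, opBump_apply, map_smul,
            Prod.smul_snd, Finset.smul_sum, smul_comm c, RingHom.id_apply] }
  op_perm {n} σ d {e} h h' μ z := by
    refine Prod.ext (X.op_perm σ d h h' μ _) ?_
    simp only [LinearMap.coe_mk, AddHom.coe_mk, MultilinearMap.prod_apply,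
      sum_apply, smul_apply, Prod.smul_snd, Finset.smul_sum]
    -- The term with `ε` in position `σ i` before permuting matches the term with `ε` in position
    -- `i` after it.
    rw [← Equiv.sum_comp σ]
    refine Finset.sum_congr rfl fun i _ => ?_
    have hs : ∑ j, bumpDeg d (σ i) (σ j) = e + 1 :=
      (Equiv.sum_comp σ (bumpDeg d (σ i))).trans (sum_bumpDeg d h _)
    rw [opBump_apply, X.op_perm σ _ _ hs, smul_smul, koszulSign_bumpDeg, smul_smul, opBump_apply]
    congr 1
    refine X.op_congr _ _ (fun j => by simp [bumpDeg_eq]) μ _ _ fun j => ?_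
    by_cases hj : j = i
    · exact (pickAt_heq_snd d (congrArg σ hj) _).trans (pickAt_heq_snd (fun j => d (σ j)) hj _).symm
    · exact (pickAt_heq_fst d (σ.injective.ne hj) _).trans
        (pickAt_heq_fst (fun j => d (σ j)) hj _).symm
  op_one {e} h z := by
    refine Prod.ext (X.op_one h _) ?_
    simp only [LinearMap.coe_mk, AddHom.coe_mk, MultilinearMap.prod_apply,
      smul_apply, Fin.sum_univ_one]
    rw [opBump_apply, leibnizSign, Finset.sum_eq_zero (by simp), pow_zero, one_smul]
    refine (X.op_congr _ _ (fun j => ?_) _ _ (fun _ => (z 0).2) fun j => ?_).trans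
      (X.op_one (e := e + 1) (by simp) _)
    · simp [bumpDeg_eq, Subsingleton.elim j 0]
    · obtain rfl := Subsingleton.elim 0 j
      exact pickAt_heq_snd _ rfl _
  op_comp {n} {m} d c {e} hc h h' μ ν z := by
    refine Prod.ext (X.op_comp d c hc h h' μ ν _) ?_
    simp only [LinearMap.coe_mk, AddHom.coe_mk, MultilinearMap.prod_apply,
      sum_apply, smul_apply]
    -- Positions of the composite are pairs `(i, j)`. On the other side the `ε`-part of the `i`-th
    -- inner operation is itself a sum over `j`, pulled out by linearity.
    rw [← finSigmaFinEquiv.sum_comp, Fintype.sum_sigma]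
    refine Finset.sum_congr rfl fun i _ => ?_
    rw [X.opBump_sum c h' μ i _ _ _ _ rfl, Finset.smul_sum]
    refine Finset.sum_congr rfl fun j _ => ?_
    rw [smul_smul, ← leibnizSign_sigma d c hc]
    congr 1
    have hc' : ∀ i', ∑ j', bumpDeg d (finSigmaFinEquiv ⟨i, j⟩) (finSigmaFinEquiv ⟨i', j'⟩) =
        bumpDeg c i i' := by
      intro i'
      simp only [bumpDeg_eq, Finset.sum_add_distrib, hc, EmbeddingLike.apply_eq_iff_eq]
      congr 1
      by_cases hi : i' = i
      · subst hi
        simp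
      · simp [hi]
    rw [opBump_apply, X.op_comp _ (bumpDeg c i) hc' _ (sum_bumpDeg c h' i), opBump_apply]
    congr 1
    funext i'
    by_cases hi : i' = i
    · subst hi
      rw [Function.update_self]
      refine eq_of_heq (HEq.trans ?_ (pickAt_heq_snd c rfl _).symm)
      rw [opBump_apply]
      refine X.op_heq _ _ (by simp [bumpDeg_eq]) (fun j' => by simp [bumpDeg_eq]) _ _ _ fun j' => ?_
      by_cases hj : j' = j
      · exact (pickAt_heq_snd d (by simp [hj]) _).trans
          (pickAt_heq_snd (fun j => d (finSigmaFinEquiv ⟨i', j⟩)) hj _).symm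
      · exact (pickAt_heq_fst d (by simp [hj]) _).trans
          (pickAt_heq_fst (fun j => d (finSigmaFinEquiv ⟨i', j⟩)) hj _).symm
    · rw [Function.update_of_ne hi]
      refine eq_of_heq (HEq.trans ?_ (pickAt_heq_fst c hi _).symm)
      refine X.op_heq _ _ (by simp [bumpDeg_eq, hi]) (fun j' => by simp [bumpDeg_eq, hi]) _ _ _
        fun j' => ?_
      exact pickAt_heq_fst d (by simp [hi]) _

end Operad.SuperAlg

/-! ### The enveloping algebra -/

section EnvelopingAlgebra

variable {P : Operad.{w, u} k} (A : Operad.Alg.{w, u, v} P)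

/-- The class of the symbol `X(l; a₁,…,aₙ)` in the enveloping algebra. -/
noncomputable def envMk {n : ℕ} (l : P.obj (Fin (n + 1))) (a : Fin n → A.carrier) : EnvAlg A :=
  RingQuot.mkAlgHom k (EnvRel A) (envX A l a)

theorem permFixLast_last {n : ℕ} (σ : Equiv.Perm (Fin n)) :
    permFixLast σ (Fin.last n) = Fin.last n := by
  simp [permFixLast]

theorem permFixLast_castSucc {n : ℕ} (σ : Equiv.Perm (Fin n)) (i : Fin n) :
    permFixLast σ i.castSucc = (σ i).castSucc := by
  simp [permFixLast]

/-- With the last slot regarded as `none`, a permutation fixing it restricts to the other slots.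
Hence the relation `EnvRel.perm` applies to every renumbering that keeps the module slot last. -/
theorem exists_permFixLast {n : ℕ} (τ : Equiv.Perm (Fin (n + 1)))
    (h : τ (Fin.last n) = Fin.last n) : ∃ σ : Equiv.Perm (Fin n), permFixLast σ = τ := by
  let τ' : Option (Fin n) ≃ Option (Fin n) :=
    (finSuccEquivLast.symm.trans τ).trans finSuccEquivLast
  have hτ' : τ' none = none := by simp [τ', h]
  refine ⟨Equiv.removeNone τ', ?_⟩
  have h2 : Equiv.optionCongr (Equiv.removeNone τ') = τ' := by
    ext1 o
    cases o with
    | none => simp [hτ']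
    | some i =>
      refine Equiv.removeNone_some τ' (Option.ne_none_iff_exists'.1 fun hi => ?_)
      exact Option.some_ne_none i (τ'.injective (hi.trans hτ'.symm))
  rw [permFixLast, h2]
  ext i
  simp [τ']

theorem envMk_map {n : ℕ} (τ : Equiv.Perm (Fin (n + 1))) (h : τ (Fin.last n) = Fin.last n)
    (l : P.obj (Fin (n + 1))) (a : Fin n → A.carrier) :
    ∃ a' : Fin n → A.carrier, envMk A (P.map τ l) a = envMk A l a' := by
  obtain ⟨σ, rfl⟩ := exists_permFixLast τ h
  exact ⟨_, RingQuot.mkAlgHom_rel k (EnvRel.perm σ l a)⟩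

theorem envMk_one (a : Fin 0 → A.carrier) : envMk A P.one₁ a = 1 :=
  (RingQuot.mkAlgHom_rel k (EnvRel.one a)).trans (map_one _)

theorem envMk_compLast {n m : ℕ} (l : P.obj (Fin (n + 1))) (l' : P.obj (Fin (m + 1)))
    (a : Fin (n + m) → A.carrier) :
    envMk A (n := n + m) (P.compLast (n := n) l l') a =
      envMk A l (fun i => a (Fin.castAdd m i)) * envMk A l' fun j => a (Fin.natAdd n j) := by
  have h := RingQuot.mkAlgHom_rel k (EnvRel.mul l l' (fun i => a (Fin.castAdd m i))
    fun j => a (Fin.natAdd n j))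
  rw [Fin.append_castAdd_natAdd, map_mul] at h
  exact h.symm

theorem envMk_compFirst {n m : ℕ} (l : P.obj (Fin (n + 1 + 1))) (μ : P.obj (Fin m))
    (a : Fin (m + n) → A.carrier) :
    envMk A (n := m + n) (P.compFirst (n := n + 1) l μ) a =
      envMk A l (Fin.cons (A.op μ fun j => a (Fin.castAdd n j)) fun i => a (Fin.natAdd m i)) := by
  have h := RingQuot.mkAlgHom_rel k (EnvRel.insert l μ (fun j => a (Fin.castAdd n j))
    fun i => a (Fin.natAdd m i))
  rw [Fin.append_castAdd_natAdd] at h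
  exact h.symm

theorem exists_equiv_last {I : Type} [Finite I] (i : I) :
    ∃ (n : ℕ) (g : I ≃ Fin (n + 1)), g i = Fin.last n := by
  obtain ⟨N, ⟨e⟩⟩ := Finite.exists_equiv_fin I
  cases N with
  | zero => exact (e i).elim0
  | succ n => exact ⟨n, e.trans (Equiv.swap (e i) (Fin.last n)), by simp⟩

/-- If `P` is generated by its binary operations, then the enveloping algebra is generated by the
elements `u(μ, a)`. -/
theorem adjoin_envU (hP : P.IsBinaryGenerated) :
    Algebra.adjoin k {x | ∃ μ a, x = envU A μ a} = ⊤ := by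
  set U := Algebra.adjoin k {x | ∃ μ a, x = envU A μ a} with hU
  -- All numberings `e` are allowed, so any input may serve as the module slot, namely the one that
  -- `e` sends to the last place.
  let S : ∀ (I : Type) [Finite I], Submodule k (P.obj I) := fun I _ =>
    { carrier := {μ | ∀ (n : ℕ) (e : I ≃ Fin (n + 1)) (a : Fin n → A.carrier),
        envMk A (P.map e μ) a ∈ U}
      add_mem' := fun {x y} hx hy n e a => by
        have h := RingQuot.mkAlgHom_rel k (EnvRel.add_left (P.map e x) (P.map e y) a)
        rw [map_add] at h
        rw [map_add, envMk, h]
        exact add_mem (hx n e a) (hy n e a)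
      zero_mem' := fun n e a => by
        have h := RingQuot.mkAlgHom_rel k (EnvRel.smul_left 0 (0 : P.obj (Fin (n + 1))) a)
        rw [map_smul, zero_smul, zero_smul] at h
        rw [map_zero, envMk, h]
        exact zero_mem _
      smul_mem' := fun c x hx n e a => by
        have h := RingQuot.mkAlgHom_rel k (EnvRel.smul_left c (P.map e x) a)
        rw [map_smul] at h
        rw [map_smul, envMk, h]
        exact Subalgebra.smul_mem _ (hx n e a) c }
  have hS : ∀ {I : Type} [Finite I] (μ : P.obj I), μ ∈ S I := by
    refine hP.mem_of_partialComp (S := S) ?_ ?_ ?_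
    · intro I J _ _ f μ hμ n e a
      rw [← P.map_trans]
      exact hμ n _ a
    · intro n e a
      obtain rfl : n = 0 := by simpa using (Nat.card_congr e).symm
      have h1 : P.map e P.one = P.one₁ := by
        rw [Operad.one₁]
        congr 2
        exact Subsingleton.elim _ _
      rw [h1, envMk_one]
      exact one_mem _
    · intro I _ l β hl n e a
      -- If the module slot belongs to `l`, then `β` acts on elements of `A` and the relation
      -- `insert` absorbs it into an argument of `l`. If it is an input of `β`, the relation `mul`
      -- splits off a factor `u(β, a)`, with the inputs of `β` swapped if necessary.
      rcases hq : e.symm (Fin.last n) with i | j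
      · obtain ⟨n', g, hg⟩ := exists_equiv_last i
        obtain rfl : n = 2 + n' := by
          have h := Nat.card_congr ((g.symm.sumCongr (Equiv.refl (Fin 2))).trans e)
          simp at h
          omega
        let f : Option I ≃ Fin (n' + 1 + 1) := g.optionCongr.trans (finSuccEquiv (n' + 1)).symm
        -- `E` is the numbering built into `compFirst`. It agrees with `e` on the module slot, so
        -- the two differ by a permutation of the arguments from `A`.
        let E : I ⊕ Fin 2 ≃ Fin (2 + n' + 1) := (g.sumCongr (Equiv.refl (Fin 2))).trans
          ((Equiv.sumComm (Fin (n' + 1)) (Fin 2)).trans finSumFinEquiv)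
        have hE : P.compFirst (n := n' + 1) (P.map f l) β = P.map E (P.partialComp l β) := by
          rw [Operad.compFirst, P.map_trans g.optionCongr, P.map_map_symm, P.partialComp_map_left,
            ← P.map_trans]
        have hEi : E (Sum.inl i) = Fin.last (2 + n') := by
          simp only [E, Equiv.trans_apply, Equiv.sumCongr_apply, Sum.map_inl, hg]
          rfl
        have h2 : P.map e (P.partialComp l β) =
            P.map (E.symm.trans e) (P.compFirst (n := n' + 1) (P.map f l) β) := by
          rw [hE, ← P.map_trans, ← Equiv.trans_assoc, Equiv.self_trans_symm, Equiv.refl_trans]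
        have h3 : (E.symm.trans e) (Fin.last (2 + n')) = Fin.last (2 + n') := by
          rw [Equiv.trans_apply, ← hEi, Equiv.symm_apply_apply, hEi, ← hq, Equiv.apply_symm_apply]
        obtain ⟨a', ha'⟩ := envMk_map A (E.symm.trans e) h3
          (P.compFirst (n := n' + 1) (P.map f l) β) a
        rw [h2, ha', envMk_compFirst]
        exact hl (n' + 1) f _
      · obtain ⟨n', ⟨g⟩⟩ := Finite.exists_equiv_fin I
        obtain rfl : n = n' + 1 := by
          have h := Nat.card_congr ((g.symm.sumCongr (Equiv.refl (Fin 2))).trans e)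
          simp at h
          omega
        let h : Fin 2 ≃ Fin (1 + 1) := Equiv.swap j (Fin.last 1)
        let f : Option I ≃ Fin (n' + 1) := g.optionCongr.trans finSuccEquivLast.symm
        let E : I ⊕ Fin 2 ≃ Fin (n' + 1 + 1) := (g.sumCongr h).trans finSumFinEquiv
        have hE : P.compLast (n := n') (P.map f l) (P.map h β) =
            P.map E (P.partialComp l β) := by
          have hgh : g.sumCongr h =
              ((Equiv.refl I).sumCongr h).trans (g.sumCongr (Equiv.refl _)) := by
            ext (x | x) <;> simp
          rw [Operad.compLast, P.map_trans g.optionCongr, P.map_map_symm, P.partialComp_map_left,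
            P.partialComp_map_right, ← P.map_trans, ← P.map_trans]
          congr 2
          simp only [E, hgh, Equiv.trans_assoc]
        have hEi : E (Sum.inr j) = Fin.last (n' + 1) := by
          simp only [E, h, Equiv.trans_apply, Equiv.sumCongr_apply, Sum.map_inr,
            Equiv.swap_apply_left]
          rfl
        have h2 : P.map e (P.partialComp l β) =
            P.map (E.symm.trans e) (P.compLast (n := n') (P.map f l) (P.map h β)) := by
          rw [hE, ← P.map_trans, ← Equiv.trans_assoc, Equiv.self_trans_symm, Equiv.refl_trans]
        have h3 : (E.symm.trans e) (Fin.last (n' + 1)) = Fin.last (n' + 1) := by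
          rw [Equiv.trans_apply, ← hEi, Equiv.symm_apply_apply, hEi, ← hq, Equiv.apply_symm_apply]
        obtain ⟨a', ha'⟩ := envMk_map A (E.symm.trans e) h3
          (P.compLast (n := n') (P.map f l) (P.map h β)) a
        rw [h2, ha', envMk_compLast]
        refine mul_mem (hl n' f _) (Algebra.subset_adjoin ⟨P.map h β, a' (Fin.natAdd n' 0), ?_⟩)
        rw [envMk, envU]
        congr 2
        funext t
        rw [Subsingleton.elim t 0]
  have key : ∀ x : FreeAlgebra k (EnvGen A),
      (show EnvAlg A from RingQuot.mkAlgHom k (EnvRel A) x) ∈ U := by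
    intro x
    induction x using FreeAlgebra.induction with
    | grade0 c =>
      have h : RingQuot.mkAlgHom k (EnvRel A) (algebraMap k _ c) = algebraMap k (EnvAlg A) c :=
        AlgHom.commutes (RingQuot.mkAlgHom k (EnvRel A)) c
      exact h ▸ Subalgebra.algebraMap_mem U c
    | grade1 g =>
      obtain ⟨n, l, a⟩ := g
      have h := hS l n (Equiv.refl _) a
      rwa [P.map_refl] at h
    | mul x y hx hy => rw [map_mul]; exact mul_mem hx hy
    | add x y hx hy => rw [map_add]; exact add_mem hx hy
  rw [eq_top_iff]
  intro x _
  obtain ⟨y, rfl⟩ := RingQuot.mkAlgHom_surjective k (EnvRel A) x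
  exact key y

/-! ### The action of the enveloping algebra along a morphism of algebras -/

variable {A} {Z : Operad.Alg.{w, u, v'} P} (η : A.Hom Z)

/-- The operator `z ↦ l(η a₁,…,η aₙ,z)`. -/
noncomputable def envOp {n : ℕ} (l : P.obj (Fin (n + 1))) (a : Fin n → A.carrier) :
    Module.End k Z.carrier :=
  (Z.op l).toLinearMap (Fin.snoc (α := fun _ => Z.carrier) (fun i => η.toFun (a i)) 0) (Fin.last n)

theorem envOp_apply {n : ℕ} (l : P.obj (Fin (n + 1))) (a : Fin n → A.carrier) (z : Z.carrier) :
    envOp η l a z =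
      Z.op l (Fin.snoc (α := fun _ => Z.carrier) (fun i => η.toFun (a i)) z) := by
  rw [envOp, MultilinearMap.toLinearMap_apply, Fin.update_snoc_last]

/-- A morphism `η : A → Z` makes `Z` a module over the enveloping algebra of `A`. -/
noncomputable def envAct : EnvAlg A →ₐ[k] Module.End k Z.carrier :=
  RingQuot.liftAlgHom k ⟨FreeAlgebra.lift k fun g : EnvGen A => envOp η g.2.1 g.2.2, by
    -- Changing an argument from `A` changes one entry of the full family, so multilinearity of the
    -- operations of `Z` gives linearity in each argument.
    have hsnoc : ∀ {n : ℕ} (a : Fin n → A.carrier) (z : Z.carrier) (i : Fin n) (y : A.carrier),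
        (Fin.snoc (α := fun _ => Z.carrier)
          (fun j => η.toFun (Function.update a i y j)) z : Fin (n + 1) → Z.carrier) =
        Function.update (Fin.snoc (α := fun _ => Z.carrier) (fun j => η.toFun (a j)) z)
          i.castSucc (η.toFun y) := by
      intro n a z i y
      funext j
      induction j using Fin.lastCases with
      | last => simp [Function.update_of_ne (Fin.castSucc_ne_last i).symm]
      | cast j =>
        by_cases h : j = i
        · subst h; simp
        · have h' : j.castSucc ≠ i.castSucc := fun H => h (Fin.castSucc_injective _ H)
          simp [Function.update_of_ne h, Function.update_of_ne h']
    intro x y hxy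
    have hX : ∀ {n : ℕ} (l : P.obj (Fin (n + 1))) (a : Fin n → A.carrier),
        FreeAlgebra.lift k (fun g : EnvGen A => envOp η g.2.1 g.2.2) (envX A l a) =
          envOp η l a := fun l a => FreeAlgebra.lift_ι_apply _ _
    induction hxy with
    | add_left l l' a =>
      ext z
      simp only [hX, map_add, LinearMap.add_apply, envOp_apply, add_apply]
    | smul_left c l a =>
      ext z
      simp only [hX, map_smul, LinearMap.smul_apply, envOp_apply, smul_apply]
    | add_arg l a i y z =>
      ext t
      simp only [hX, map_add, LinearMap.add_apply, envOp_apply, hsnoc,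
        MultilinearMap.map_update_add]
    | smul_arg l a i c y =>
      ext t
      simp only [hX, map_smul, LinearMap.smul_apply, envOp_apply, hsnoc,
        MultilinearMap.map_update_smul]
    | perm σ l a =>
      ext z
      rw [hX, hX, envOp_apply, envOp_apply, Z.op_perm]
      congr 1
      funext j
      induction j using Fin.lastCases <;> simp [permFixLast_last, permFixLast_castSucc]
    | one a =>
      ext z
      rw [hX, map_one, envOp_apply, Z.op_one]
      rfl
    | @mul n m l l' a b =>
      ext z
      rw [map_mul, hX, hX, hX, Module.End.mul_apply, envOp_apply, envOp_apply, envOp_apply]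
      refine Eq.trans ?_ (Z.op_compLast l l' _).symm
      -- These values are stated over `Fin (n + m + 1)` and used over the definitionally equal `Fin
      -- (n + (m + 1))`.
      have hs := Fin.snoc_castSucc (α := fun _ => Z.carrier) z
        (fun i => η.toFun (Fin.append a b i))
      have hl := Fin.snoc_last (α := fun _ => Z.carrier) z
        (fun i => η.toFun (Fin.append a b i))
      congr 1
      funext j
      induction j using Fin.lastCases with
      | last =>
        simp only [Fin.snoc_last]
        congr 1
        funext t
        induction t using Fin.lastCases with
        | last => exact (Fin.snoc_last _ _).trans hl.symm
        | cast t =>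
          refine (Fin.snoc_castSucc _ _ _).trans (Eq.trans ?_ (hs (Fin.natAdd n t)).symm)
          rw [Fin.append_right]
      | cast j =>
        simp only [Fin.snoc_castSucc]
        refine Eq.trans ?_ (hs (Fin.castAdd m j)).symm
        rw [Fin.append_left]
    | @insert n m l μ b a =>
      ext z
      rw [hX, hX, envOp_apply, envOp_apply]
      refine Eq.trans ?_ (Z.op_compFirst l μ _).symm
      have hs := Fin.snoc_castSucc (α := fun _ => Z.carrier) z
        (fun i => η.toFun (Fin.append b a i))
      have hl := Fin.snoc_last (α := fun _ => Z.carrier) z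
        (fun i => η.toFun (Fin.append b a i))
      congr 1
      funext j
      induction j using Fin.lastCases with
      | last => exact (Fin.snoc_last _ _).trans hl.symm
      | cast j =>
        refine (Fin.snoc_castSucc _ _ _).trans ?_
        induction j using Fin.cases with
        | zero =>
          refine (η.map_op μ b).trans (congrArg (Z.op μ) (funext fun t => ?_))
          refine Eq.trans ?_ (hs (Fin.castAdd n t)).symm
          rw [Fin.append_left]
        | succ j =>
          refine Eq.trans ?_ (hs (Fin.natAdd m j)).symm
          rw [Fin.append_right, Fin.cons_succ]⟩

theorem envAct_envU (μ : P.obj (Fin 2)) (a : A.carrier) (z : Z.carrier) :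
    envAct η (envU A μ a) z = Z.op μ ![η.toFun a, z] := by
  have h : envAct η (envU A μ a) = envOp η (n := 1) μ fun _ => a := by
    exact (RingQuot.liftAlgHom_mkAlgHom_apply k _ _ _).trans (FreeAlgebra.lift_ι_apply _ _)
  rw [h, envOp_apply]
  congr 1
  funext j
  fin_cases j <;> rfl

end EnvelopingAlgebra

/-! ### Binary operations in superalgebras -/

namespace Operad.SuperAlg

variable {P : Operad.{w, u} k} (X : Operad.SuperAlg.{w, u, v} P)

theorem zeroPart_op_two (μ : P.obj (Fin 2)) (a b : X.obj 0) :
    X.zeroPart.op μ ![a, b] = X.op ![0, 0] (by simp) μ (pair a b) := by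
  refine X.op_congr (d := fun _ => 0) _ _ (fun i => ?_) μ _ _ fun i => ?_
  · fin_cases i <;> rfl
  · fin_cases i <;> rfl

theorem op_flip {p q e : ℕ} (h : ∑ i, ![p, q] i = e) (h' : ∑ i, ![q, p] i = e)
    (μ : P.obj (Fin 2)) (x : X.obj p) (y : X.obj q) :
    X.op ![p, q] h (P.flip μ) (pair x y) = (-1 : k) ^ (p * q) • X.op ![q, p] h' μ (pair y x) := by
  have hs : koszulSign k (Equiv.swap 0 1) ![p, q] = (-1) ^ (p * q) := by
    simp [koszulSign, Fin.prod_univ_two, mul_comm]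
  have h2 : ∑ i, ![p, q] (Equiv.swap 0 1 i) = e := by
    rw [← h]
    exact Equiv.sum_comp (Equiv.swap 0 1) ![p, q]
  rw [Operad.flip, X.op_perm _ _ _ h2, hs]
  congr 1
  refine X.op_congr _ _ (fun i => ?_) μ _ _ fun i => ?_
  · fin_cases i <;> rfl
  · fin_cases i <;> rfl

theorem op_pair_zero_left {p q e : ℕ} (h : ∑ i, ![p, q] i = e) (μ : P.obj (Fin 2))
    (y : X.obj q) : X.op ![p, q] h μ (pair 0 y) = 0 :=
  MultilinearMap.map_coord_zero _ 0 rfl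

theorem op_pair_zero_right {p q e : ℕ} (h : ∑ i, ![p, q] i = e) (μ : P.obj (Fin 2))
    (x : X.obj p) : X.op ![p, q] h μ (pair x 0) = 0 :=
  MultilinearMap.map_coord_zero _ 1 rfl

theorem eps_op_fst {n : ℕ} (d : Fin n → ℕ) {e : ℕ} (h : ∑ i, d i = e) (μ : P.obj (Fin n))
    (z : ∀ i, X.eps.obj (d i)) : (X.eps.op d h μ z).1 = X.op d h μ fun i => (z i).1 := rfl

theorem eps_op_snd {n : ℕ} (d : Fin n → ℕ) {e : ℕ} (h : ∑ i, d i = e) (μ : P.obj (Fin n))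
    (z : ∀ i, X.obj (d i) × X.obj (d i + 1)) :
    (X.eps.op d h μ z).2 = ∑ i, leibnizSign k d i • X.opBump d h μ i z := by
  have key : ∀ f : Fin n → MultilinearMap k (fun i => X.obj (d i) × X.obj (d i + 1))
      (X.obj (e + 1)), (∑ i, f i) z = ∑ i, f i z := fun f => sum_apply _ _ _
  exact key _

/-- The `ε` comes from one of the two factors, and moving it past the first factor costs `(-1) ^ p`.
-/
theorem eps_op_pair {p q e : ℕ} (h : ∑ i, ![p, q] i = e) (h₁ : ∑ i, ![p + 1, q] i = e + 1)
    (h₂ : ∑ i, ![p, q + 1] i = e + 1) (μ : P.obj (Fin 2)) (x : X.eps.obj p) (y : X.eps.obj q) :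
    X.eps.op ![p, q] h μ (pair x y) = (X.op ![p, q] h μ (pair x.1 y.1),
      X.op ![p + 1, q] h₁ μ (pair x.2 y.1) +
        (-1 : k) ^ p • X.op ![p, q + 1] h₂ μ (pair x.1 y.2)) := by
  refine Prod.ext ?_ ?_
  · rw [eps_op_fst]
    refine X.op_congr _ _ (fun i => rfl) μ _ _ fun i => ?_
    fin_cases i <;> rfl
  · refine (X.eps_op_snd _ h μ _).trans ?_
    rw [Fin.sum_univ_two]
    have s0 : leibnizSign k ![p, q] 0 = 1 := by simp [leibnizSign]
    have s1 : leibnizSign k ![p, q] 1 = (-1) ^ p := by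
      simp [leibnizSign_eq_prod]
    rw [s0, s1, one_smul]
    refine congrArg₂ (· + ·) ?_ (congrArg _ ?_)
    · refine X.op_congr (d := bumpDeg ![p, q] 0) _ _ (fun i => ?_) μ _ _ fun i => ?_
      · fin_cases i <;> rfl
      · fin_cases i <;> rfl
    · refine X.op_congr (d := bumpDeg ![p, q] 1) _ _ (fun i => ?_) μ _ _ fun i => ?_
      · fin_cases i <;> rfl
      · fin_cases i <;> rfl

end Operad.SuperAlg

/-! ### Universal properties -/

section Universal

variable {P : Operad.{w, u} k} {A : Operad.Alg.{w, u, v} P}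

/-- The universal property of the module of Kähler differentials. -/
theorem Kahler.exists_lift {Z : Operad.Alg.{w, u, v'} P} (η : A.Hom Z)
    (g : A.carrier →ₗ[k] Z.carrier)
    (hg : ∀ (μ : P.obj (Fin 2)) (a b : A.carrier), g (A.op μ ![a, b]) =
      Z.op μ ![η.toFun a, g b] + Z.op (P.flip μ) ![η.toFun b, g a]) :
    ∃ f : Kahler A →+ Z.carrier, (∀ (r : EnvAlg A) (m : Kahler A), f (r • m) = envAct η r (f m)) ∧
      ∀ a, f (kahlerD A a) = g a := by
  -- With `Z` a module through `η`, the map on the free module over the symbols `da` kills the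
  -- Leibniz relations exactly by `hg`.
  let _ : Module (EnvAlg A) Z.carrier := Module.compHom _ (envAct η).toRingHom
  have hsmul : ∀ (r : EnvAlg A) (z : Z.carrier), r • z = envAct η r z := fun _ _ => rfl
  let f₀ : (A.carrier →₀ EnvAlg A) →ₗ[EnvAlg A] Z.carrier :=
    Finsupp.linearCombination (EnvAlg A) fun a => g a
  have hf₀ : ∀ a, f₀ (Finsupp.single a 1) = g a := fun a => by
    simp only [f₀, Finsupp.linearCombination_single, one_smul]
  let f : Kahler A →ₗ[EnvAlg A] Z.carrier := Submodule.liftQ _ f₀ (by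
    rw [Submodule.span_le]
    rintro x hx
    change f₀ x = 0
    cases hx with
    | linear c c' a a' =>
      rw [map_sub, map_add, map_smul, map_smul, hf₀, hf₀, hf₀, hsmul, hsmul, AlgHom.commutes,
        AlgHom.commutes, Module.algebraMap_end_apply, Module.algebraMap_end_apply, map_add,
        map_smul, map_smul, sub_self]
    | leibniz μ a a' =>
      rw [map_sub, map_add, map_smul, map_smul, hf₀, hf₀, hf₀, hsmul, hsmul, envAct_envU,
        envAct_envU, hg, sub_self])
  refine ⟨f.toAddMonoidHom, fun r m => f.map_smul r m, fun a => ?_⟩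
  exact hf₀ a

/-! ### Morphisms out of the tensor superalgebra -/

section Tensor

variable {M : Type v'} {Y : Operad.SuperAlg.{w, u, v''} P}

/-- The value of a formal expression in a superalgebra. -/
def TExpr.eval (ρ : A.carrier → Y.obj 0) (f : M → Y.obj 1) : ∀ {e : ℕ}, TExpr A M e → Y.obj e
  | _, .ofA a => ρ a
  | _, .ofM m => f m
  | _, .zero _ => 0
  | _, .add x y => x.eval ρ f + y.eval ρ f
  | _, .smul c x => c • x.eval ρ f
  | _, .op d h μ x => Y.op d h μ fun i => (x i).eval ρ f

theorem TExpr.eval_pair (ρ : A.carrier → Y.obj 0) (f : M → Y.obj 1) {p q e : ℕ}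
    (h : ∑ i, ![p, q] i = e) (μ : P.obj (Fin 2)) (x : TExpr A M p) (y : TExpr A M q) :
    TExpr.eval ρ f (.op ![p, q] h μ (pair x y)) =
      Y.op ![p, q] h μ (pair (x.eval ρ f) (y.eval ρ f)) := by
  rw [TExpr.eval]
  congr 1
  funext i
  fin_cases i <;> rfl

theorem TExpr.eval_update (ρ : A.carrier → Y.obj 0) (f : M → Y.obj 1) {n : ℕ} {d : Fin n → ℕ}
    (x : ∀ i, TExpr A M (d i)) (i : Fin n) (y : TExpr A M (d i)) :
    (fun j => (Function.update x i y j).eval ρ f) =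
      Function.update (fun j => (x j).eval ρ f) i (y.eval ρ f) := by
  funext j
  by_cases h : j = i
  · subst h
    simp
  · simp [Function.update_of_ne h]

variable [AddCommGroup M] [Module (EnvAlg A) M]

/-- Each generator of the congruence is an axiom of `Y` or a hypothesis, except the relation for
`μ(m, a)`. That one follows from the case `μ(a, m)` by flipping, with trivial sign since `a` is
even. -/
theorem TExpr.eval_eq_of_rel (ρ : A.carrier →ₗ[k] Y.obj 0) (f : M →+ Y.obj 1)
    (hρ : ∀ (μ : P.obj (Fin 2)) (a b : A.carrier),
      ρ (A.op μ ![a, b]) = Y.op ![0, 0] (by simp) μ (pair (ρ a) (ρ b)))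
    (hf : ∀ (c : k) (m : M), f (algebraMap k (EnvAlg A) c • m) = c • f m)
    (hu : ∀ (μ : P.obj (Fin 2)) (a : A.carrier) (m : M),
      f (envU A μ a • m) = Y.op ![0, 1] (by simp) μ (pair (ρ a) (f m)))
    {e : ℕ} {x y : TExpr A M e} (h : TRel A M x y) : x.eval ρ f = y.eval ρ f := by
  induction h with
  | refl => rfl
  | symm _ ih => exact ih.symm
  | trans _ _ ih ih' => exact ih.trans ih'
  | add_congr _ _ ih ih' => simp only [TExpr.eval, ih, ih']
  | smul_congr c _ ih => simp only [TExpr.eval, ih]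
  | op_congr d h μ _ ih => simp only [TExpr.eval, ih]
  | add_assoc => simp only [TExpr.eval, add_assoc]
  | add_comm x y => simp only [TExpr.eval, add_comm (x.eval ρ f)]
  | zero_add => simp only [TExpr.eval, zero_add]
  | neg_add => simp only [TExpr.eval, neg_smul, one_smul, neg_add_cancel]
  | one_smul => simp only [TExpr.eval, one_smul]
  | mul_smul => simp only [TExpr.eval, mul_smul]
  | smul_add => simp only [TExpr.eval, smul_add]
  | add_smul => simp only [TExpr.eval, add_smul]
  | op_add_left => simp only [TExpr.eval, map_add, add_apply]
  | op_smul_left => simp only [TExpr.eval, map_smul, smul_apply]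
  | op_add_arg => simp only [TExpr.eval, TExpr.eval_update, MultilinearMap.map_update_add]
  | op_smul_arg => simp only [TExpr.eval, TExpr.eval_update, MultilinearMap.map_update_smul]
  | op_perm σ d h h' μ x => exact Y.op_perm σ d h h' μ _
  | op_one h x => exact Y.op_one h _
  | op_comp d c hc h h' μ ν x => exact Y.op_comp d c hc h h' μ ν _
  | ofA_add => exact map_add _ _ _
  | ofA_smul => exact map_smul _ _ _
  | ofM_add => exact map_add _ _ _
  | ofM_smul => exact hf _ _
  | rel_AA μ a b => rw [TExpr.eval_pair]; exact (hρ μ a b).symm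
  | rel_AM μ a m => rw [TExpr.eval_pair]; exact (hu μ a m).symm
  | rel_MA μ m a =>
    rw [TExpr.eval_pair]
    refine Eq.trans ?_ (hu (P.flip μ) a m).symm
    rw [Y.op_flip _ (by simp)]
    simp only [TExpr.eval, zero_mul, pow_zero, one_smul]

/-- The universal property of the tensor superalgebra. -/
theorem tensorAlg.exists_lift (ρ : A.carrier →ₗ[k] Y.obj 0) (f : M →+ Y.obj 1)
    (hρ : ∀ (μ : P.obj (Fin 2)) (a b : A.carrier),
      ρ (A.op μ ![a, b]) = Y.op ![0, 0] (by simp) μ (pair (ρ a) (ρ b)))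
    (hf : ∀ (c : k) (m : M), f (algebraMap k (EnvAlg A) c • m) = c • f m)
    (hu : ∀ (μ : P.obj (Fin 2)) (a : A.carrier) (m : M),
      f (envU A μ a • m) = Y.op ![0, 1] (by simp) μ (pair (ρ a) (f m))) :
    ∃ F : (tensorAlg A M).Hom Y, (∀ a, F.app 0 (tmk A M (.ofA a)) = ρ a) ∧
      ∀ m, F.app 1 (tmk A M (.ofM m)) = f m := by
  let F₀ : ∀ e, TObj A M e → Y.obj e := fun e =>
    Quotient.lift (TExpr.eval ρ f) fun _ _ h => TExpr.eval_eq_of_rel ρ f hρ hf hu h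
  -- Operations on classes are defined through representatives, so the value of `F₀` has to be read
  -- off on them.
  have hF₀ : ∀ {e} (x : TObj A M e), F₀ e x = x.rep.eval ρ f := fun x => by
    conv_lhs => rw [← tmk_rep x]
    rfl
  refine ⟨{ app := fun e =>
              { toFun := F₀ e
                map_add' := fun x y => ?_
                map_smul' := fun c x => ?_ }
            map_op := fun d e h μ x => ?_ }, fun _ => rfl, fun _ => rfl⟩
  · induction x using tind
    induction y using tind
    rfl
  · induction x using tind
    rfl
  · refine Eq.trans ?_ (congrArg (Y.op d h μ) (funext fun i => (hF₀ (x i)).symm))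
    rfl

end Tensor

/-! ### Generators and universal property of the superalgebra of forms -/

namespace Omega

variable (A) in
theorem ofA_add (a b : A.carrier) : ofA A (a + b) = ofA A a + ofA A b := tmk_eq (.ofA_add a b)

variable (A) in
theorem ofA_smul (c : k) (a : A.carrier) : ofA A (c • a) = c • ofA A a := tmk_eq (.ofA_smul c a)

theorem op_ofA_ofA (μ : P.obj (Fin 2)) (a b : A.carrier) :
    (Omega A).op ![0, 0] (by simp) μ (pair (ofA A a) (ofA A b)) = ofA A (A.op μ ![a, b]) := by
  refine Eq.trans ?_ (tmk_eq (TRel.rel_AA μ a b))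
  refine Eq.trans ?_ (tOp_tmk ![0, 0] (by simp) μ _)
  exact (Omega A).op_congr _ _ (fun _ => rfl) μ _ _ fun i => by fin_cases i <;> rfl

theorem op_ofA_ofKahler (μ : P.obj (Fin 2)) (a : A.carrier) (m : Kahler A) :
    (Omega A).op ![0, 1] (by simp) μ (pair (ofA A a) (ofKahler A m)) =
      ofKahler A (envU A μ a • m) := by
  refine Eq.trans ?_ (tmk_eq (TRel.rel_AM μ a m))
  refine Eq.trans ?_ (tOp_tmk ![0, 1] (by simp) μ _)
  exact (Omega A).op_congr _ _ (fun _ => rfl) μ _ _ fun i => by fin_cases i <;> rfl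

theorem op_ofKahler_ofA (μ : P.obj (Fin 2)) (m : Kahler A) (a : A.carrier) :
    (Omega A).op ![1, 0] (by simp) μ (pair (ofKahler A m) (ofA A a)) =
      ofKahler A (envU A (P.flip μ) a • m) := by
  refine Eq.trans ?_ (tmk_eq (TRel.rel_MA μ m a))
  refine Eq.trans ?_ (tOp_tmk ![1, 0] (by simp) μ _)
  exact (Omega A).op_congr _ _ (fun _ => rfl) μ _ _ fun i => by fin_cases i <;> rfl

theorem ofKahler_add (m m' : Kahler A) :
    ofKahler A (m + m') = ofKahler A m + ofKahler A m' := tmk_eq (.ofM_add m m')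

theorem ofKahler_algebraMap_smul (c : k) (m : Kahler A) :
    ofKahler A (algebraMap k (EnvAlg A) c • m) = c • ofKahler A m := tmk_eq (.ofM_smul c m)

variable (A) in
theorem ofKahler_zero : ofKahler A 0 = 0 := by
  simpa using ofKahler_add (0 : Kahler A) 0

/-- The superalgebra of forms is generated by the elements `a` and `da`. -/
theorem mem_of_generators (hP : P.IsBinaryGenerated)
    (p : ∀ e, Submodule k ((Omega A).obj e))
    (hop : ∀ {n : ℕ} (d : Fin n → ℕ) {e : ℕ} (h : ∑ i, d i = e) (μ : P.obj (Fin n))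
      (x : ∀ i, (Omega A).obj (d i)), (∀ i, x i ∈ p (d i)) → (Omega A).op d h μ x ∈ p e)
    (hA : ∀ a, ofA A a ∈ p 0) (hd : ∀ a, ofKahler A (kahlerD A a) ∈ p 1)
    {e : ℕ} (x : (Omega A).obj e) : x ∈ p e := by
  -- It suffices to act by the generators `u(μ, a)`, and these act as the operation `μ` with first
  -- argument `a`.
  have hsmul : ∀ (r : EnvAlg A) (m : Kahler A), ofKahler A m ∈ p 1 → ofKahler A (r • m) ∈ p 1 := by
    intro r
    have hr : r ∈ Algebra.adjoin k {x | ∃ μ a, x = envU A μ a} := by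
      rw [adjoin_envU A hP]
      trivial
    induction hr using Algebra.adjoin_induction with
    | mem x hx =>
      obtain ⟨μ, a, rfl⟩ := hx
      intro m hm
      rw [← op_ofA_ofKahler]
      refine hop _ _ _ _ fun i => ?_
      fin_cases i
      exacts [hA a, hm]
    | algebraMap c =>
      intro m hm
      rw [ofKahler_algebraMap_smul]
      exact Submodule.smul_mem _ _ hm
    | add x y _ _ hx hy =>
      intro m hm
      rw [add_smul, ofKahler_add]
      exact add_mem (hx m hm) (hy m hm)
    | mul x y _ _ hx hy =>
      intro m hm
      rw [mul_smul]
      exact hx _ (hy m hm)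
  have hM : ∀ m : Kahler A, ofKahler A m ∈ p 1 := by
    intro m
    induction m using Submodule.Quotient.induction_on with
    | H s =>
      induction s using Finsupp.induction_linear with
      | zero =>
        rw [Submodule.Quotient.mk_zero, ofKahler_zero]
        exact zero_mem _
      | add f g hf hg =>
        rw [Submodule.Quotient.mk_add, ofKahler_add]
        exact add_mem hf hg
      | single a r =>
        have h : (Finsupp.single a r : A.carrier →₀ EnvAlg A) = r • Finsupp.single a 1 := by simp
        rw [h, Submodule.Quotient.mk_smul]
        exact hsmul r _ (hd a)
  induction x using tind with
  | h x =>
    induction x with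
    | ofA a => exact hA a
    | ofM m => exact hM m
    | zero => exact zero_mem _
    | add x y hx hy => exact add_mem hx hy
    | smul c x hx => exact Submodule.smul_mem _ c hx
    | op d h μ x hx => exact tOp_tmk d h μ x ▸ hop d h μ _ hx

theorem hom_ext (hP : P.IsBinaryGenerated) {Y : Operad.SuperAlg.{w, u, v'} P}
    {F G : (Omega A).Hom Y} (hA : ∀ a, F.app 0 (ofA A a) = G.app 0 (ofA A a))
    (hd : ∀ a, F.app 1 (ofKahler A (kahlerD A a)) = G.app 1 (ofKahler A (kahlerD A a))) :
    F = G := by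
  refine Operad.SuperAlg.Hom.ext (funext fun e => LinearMap.ext fun x => ?_)
  refine mem_of_generators hP (fun e => LinearMap.eqLocus (F.app e) (G.app e)) ?_ hA hd x
  intro n d e h μ x hx
  rw [LinearMap.mem_eqLocus, F.map_op, G.map_op]
  congr 1
  exact funext hx

variable (A) in
theorem kahlerD_linear (c c' : k) (a a' : A.carrier) :
    kahlerD A (c • a + c' • a') =
      algebraMap k (EnvAlg A) c • kahlerD A a + algebraMap k (EnvAlg A) c' • kahlerD A a' :=
  (Submodule.Quotient.eq _).2 (Submodule.subset_span (KahlerRel.linear c c' a a'))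

theorem kahlerD_op (μ : P.obj (Fin 2)) (a a' : A.carrier) :
    kahlerD A (A.op μ ![a, a']) = envU A μ a • kahlerD A a' + envU A (P.flip μ) a' • kahlerD A a :=
  (Submodule.Quotient.eq _).2 (Submodule.subset_span (KahlerRel.leibniz μ a a'))

variable (A) in
/-- The inclusion of `A` as a linear map. -/
noncomputable def ofAHom : A.carrier →ₗ[k] (Omega A).obj 0 where
  toFun := ofA A
  map_add' := ofA_add A
  map_smul' := ofA_smul A

variable (A) in
/-- The universal derivation as a linear map to the forms of degree one. -/
noncomputable def ofKahlerD : A.carrier →ₗ[k] (Omega A).obj 1 where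
  toFun a := ofKahler A (kahlerD A a)
  map_add' a b := by
    have h := kahlerD_linear A 1 1 a b
    rw [one_smul, one_smul, map_one, one_smul, one_smul] at h
    rw [h, ofKahler_add]
  map_smul' c a := by
    have h := kahlerD_linear A c 0 a 0
    rw [smul_zero, add_zero, map_zero, zero_smul, add_zero] at h
    rw [h, ofKahler_algebraMap_smul, RingHom.id_apply]

theorem ofKahlerD_op (μ : P.obj (Fin 2)) (a b : A.carrier) :
    ofKahlerD A (A.op μ ![a, b]) =
      (Omega A).op ![0, 1] (by simp) μ (pair (ofA A a) (ofKahlerD A b)) +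
        (Omega A).op ![1, 0] (by simp) μ (pair (ofKahlerD A a) (ofA A b)) := by
  refine Eq.trans (congrArg (ofKahler A) (kahlerD_op μ a b)) ?_
  rw [ofKahler_add, ← op_ofA_ofKahler, ← op_ofKahler_ofA]
  rfl

/-- Morphisms from the superalgebra of forms are determined by the images of `a` and `da`, which
have to satisfy the Leibniz rule for binary operations. -/
theorem exists_lift (hP : P.IsBinaryGenerated) {Y : Operad.SuperAlg.{w, u, v'} P}
    (ρ : A.carrier →ₗ[k] Y.obj 0) (δ : A.carrier →ₗ[k] Y.obj 1)
    (hρ : ∀ (μ : P.obj (Fin 2)) (a b : A.carrier),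
      ρ (A.op μ ![a, b]) = Y.op ![0, 0] (by simp) μ (pair (ρ a) (ρ b)))
    (hδ : ∀ (μ : P.obj (Fin 2)) (a b : A.carrier),
      δ (A.op μ ![a, b]) = Y.op ![0, 1] (by simp) μ (pair (ρ a) (δ b)) +
        Y.op ![1, 0] (by simp) μ (pair (δ a) (ρ b))) :
    ∃ F : (Omega A).Hom Y, (∀ a, F.app 0 (ofA A a) = ρ a) ∧
      ∀ a, F.app 1 (ofKahler A (kahlerD A a)) = δ a := by
  -- In degree zero `Y[ε]` is the square-zero extension of `Y₀` by `Y₁`: an honest `P`-algebra on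
  -- which the enveloping algebra acts through `a ↦ (ρ a, 0)`.
  have hZ : ∀ (μ : P.obj (Fin 2)) (z z' : Y.obj 0 × Y.obj 1),
      Y.eps.zeroPart.op μ ![z, z'] = (Y.op ![0, 0] (by simp) μ (pair z.1 z'.1),
        Y.op ![1, 0] (by simp) μ (pair z.2 z'.1) + Y.op ![0, 1] (by simp) μ (pair z.1 z'.2)) := by
    intro μ z z'
    refine (Y.eps.zeroPart_op_two μ z z').trans ((Y.eps_op_pair _ (by simp) (by simp) μ z z').trans ?_)
    rw [pow_zero, one_smul]
  let ρ' : A.carrier →ₗ[k] Y.eps.zeroPart.carrier := LinearMap.inl k (Y.obj 0) (Y.obj 1) ∘ₗ ρ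
  let δ' : A.carrier →ₗ[k] Y.eps.zeroPart.carrier := LinearMap.inr k (Y.obj 0) (Y.obj 1) ∘ₗ δ
  have hρ' : ∀ a, ρ' a = (ρ a, 0) := fun _ => rfl
  have hδ' : ∀ a, δ' a = (0, δ a) := fun _ => rfl
  let η : A.Hom Y.eps.zeroPart := Operad.Alg.Hom.ofBinary hP ρ' (by
    intro μ a b
    refine Eq.trans ?_ (hZ μ (ρ a, 0) (ρ b, 0)).symm
    refine Prod.ext (hρ μ a b) ?_
    change 0 = Y.op ![1, 0] _ μ (pair 0 (ρ b)) + Y.op ![0, 1] _ μ (pair (ρ a) 0)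
    rw [Y.op_pair_zero_left, Y.op_pair_zero_right, add_zero])
  have hη : ∀ a, η.toFun a = (ρ a, 0) := fun _ => rfl
  obtain ⟨f, hf, hfd⟩ := Kahler.exists_lift η δ' (by
    intro μ a b
    refine Eq.trans ?_ (congrArg₂ (fun x y : Y.obj 0 × Y.obj 1 => x + y)
      (hZ μ (ρ a, 0) (0, δ b)) (hZ (P.flip μ) (ρ b, 0) (0, δ a))).symm
    refine Prod.ext ?_ ?_
    · change 0 = Y.op ![0, 0] _ μ (pair (ρ a) 0) + Y.op ![0, 0] _ (P.flip μ) (pair (ρ b) 0)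
      rw [Y.op_pair_zero_right, Y.op_pair_zero_right, add_zero]
    · change δ (A.op μ ![a, b]) =
        Y.op ![1, 0] _ μ (pair 0 0) + Y.op ![0, 1] _ μ (pair (ρ a) (δ b)) +
          (Y.op ![1, 0] _ (P.flip μ) (pair 0 0) + Y.op ![0, 1] _ (P.flip μ) (pair (ρ b) (δ a)))
      rw [Y.op_pair_zero_left, Y.op_pair_zero_left, hδ]
      refine congrArg₂ (· + ·) (zero_add _).symm (Eq.trans ?_ (zero_add _).symm)
      refine ((Y.op_flip (p := 0) (q := 1) _ (by simp) μ _ _).trans ?_).symm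
      rw [Nat.zero_mul, pow_zero, one_smul])
  -- Only the `Y₁`-component of `f` is kept; since `η a` has no `ε`-part, `u(μ, a)` acts on that
  -- component as `μ(ρ a, ·)`.
  obtain ⟨F, hF, hF'⟩ := tensorAlg.exists_lift (Y := Y) ρ
    ((AddMonoidHom.snd (Y.obj 0) (Y.obj 1)).comp f) hρ
    (fun c m => by
      have h := hf (algebraMap k (EnvAlg A) c) m
      rw [AlgHom.commutes, Module.algebraMap_end_apply] at h
      exact congrArg Prod.snd h)
    (fun μ a m => by
      have h := hf (envU A μ a) m
      rw [envAct_envU, hη] at h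
      refine (congrArg Prod.snd (h.trans (hZ μ (ρ a, 0) (f m)))).trans ?_
      change Y.op ![1, 0] _ μ (pair 0 _) + _ = _
      rw [Y.op_pair_zero_left]
      exact zero_add _)
  exact ⟨F, hF, fun a => (hF' _).trans (congrArg Prod.snd (hfd a))⟩

end Omega

end Universal

/-! ### Derivations of degree one -/

section Apply

variable {X : ℕ → Type v} (δ : ∀ i, X i → X (i + 1)) {n : ℕ} {d : Fin n → ℕ} (x : ∀ j, X (d j))

theorem applyAt_heq_self {i j : Fin n} (h : j = i) : applyAt δ x i j ≍ δ _ (x j) := by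
  have key : ∀ b : Bool, b = true → applyIf δ (x j) b ≍ δ _ (x j) := by
    rintro _ rfl
    rfl
  exact key _ (by simp [h])

theorem applyAt_heq_of_ne {i j : Fin n} (h : j ≠ i) : applyAt δ x i j ≍ x j := by
  have key : ∀ b : Bool, b = false → applyIf δ (x j) b ≍ x j := by
    rintro _ rfl
    rfl
  exact key _ (by simp [h])

theorem heq_apply {a b : ℕ} (h : a = b) {x : X a} {y : X b} (hxy : x ≍ y) : δ a x ≍ δ b y := by
  subst h
  rw [eq_of_heq hxy]

theorem applyAt_applyAt_heq {i j l : Fin n} (hij : i ≠ j) :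
    applyAt δ (applyAt δ x i) j l ≍ applyAt δ (applyAt δ x j) i l := by
  by_cases hi : l = i
  · have hj : l ≠ j := fun h => hij (hi.symm.trans h)
    exact ((applyAt_heq_of_ne δ _ hj).trans (applyAt_heq_self δ x hi)).trans
      ((applyAt_heq_self δ _ hi).trans
        (heq_apply δ (by simp [bumpDeg_eq, hj]) (applyAt_heq_of_ne δ x hj))).symm
  · by_cases hj : l = j
    · exact ((applyAt_heq_self δ _ hj).trans
        (heq_apply δ (by simp [bumpDeg_eq, hi]) (applyAt_heq_of_ne δ x hi))).trans
        ((applyAt_heq_of_ne δ _ hi).trans (applyAt_heq_self δ x hj)).symm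
    · exact ((applyAt_heq_of_ne δ _ hj).trans (applyAt_heq_of_ne δ x hi)).trans
        ((applyAt_heq_of_ne δ _ hi).trans (applyAt_heq_of_ne δ x hj)).symm

theorem map_applyAt {Y : ℕ → Type v'} (δ' : ∀ i, Y i → Y (i + 1)) (F : ∀ i, X i → Y i)
    (hx : ∀ j, F _ (δ _ (x j)) = δ' _ (F _ (x j))) (i j : Fin n) :
    F _ (applyAt δ x i j) = applyAt δ' (fun j => F _ (x j)) i j := by
  have key : ∀ b : Bool, F _ (applyIf δ (x j) b) = applyIf δ' (F _ (x j)) b := by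
    rintro (_ | _)
    · rfl
    · exact hx j
  exact key _

end Apply

/-- An odd operator already placed at `i` is passed on the way to `j` only if `i < j`. Of the two
orders of acting at `i ≠ j` exactly one picks up the extra sign, so the mixed terms of a square
cancel. -/
theorem leibnizSign_bumpDeg {n : ℕ} (d : Fin n → ℕ) (i j : Fin n) :
    leibnizSign k (bumpDeg d i) j = leibnizSign k d j * if i < j then -1 else 1 := by
  have h : ∀ l, (if l < j then (-1 : k) ^ bumpDeg d i l else 1) =
      (if l < j then (-1 : k) ^ d l else 1) * if l = i then (if i < j then -1 else 1) else 1 := by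
    intro l
    rw [bumpDeg_eq]
    by_cases hl : l = i
    · subst hl
      by_cases hj : l < j <;> simp [hj, pow_succ]
    · simp [hl]
  rw [leibnizSign_eq_prod, leibnizSign_eq_prod, Finset.prod_congr rfl fun l _ => h l,
    Finset.prod_mul_distrib]
  simp

namespace Operad.SuperAlg

variable {P : Operad.{w, u} k} (X : Operad.SuperAlg.{w, u, v} P)

/-- The Leibniz rule for `δ` expresses that `x ↦ x + ε δ x` is a morphism. -/
theorem eps_op_graph (δ : ∀ i, X.obj i → X.obj (i + 1)) {n : ℕ} (d : Fin n → ℕ) {e : ℕ}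
    (h : ∑ i, d i = e) (μ : P.obj (Fin n)) (x : ∀ i, X.obj (d i)) :
    (X.eps.op d h μ fun i => (x i, δ _ (x i))).2 =
      ∑ i, (-1 : k) ^ (∑ j ∈ Finset.univ.filter (· < i), d j) •
        X.op (bumpDeg d i) (sum_bumpDeg d h i) μ (applyAt δ x i) := by
  refine (X.eps_op_snd d h μ _).trans (Finset.sum_congr rfl fun i _ => ?_)
  refine congrArg (leibnizSign k d i • ·) (congrArg (X.op _ _ μ) (funext fun j => ?_))
  have key : ∀ b : Bool, selectEntry (k := k) (X := X.obj) (d j) b (x j, δ _ (x j)) =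
      applyIf δ (x j) b := by
    rintro (_ | _) <;> rfl
  exact key _

theorem Differential.op_pair {X : Operad.SuperAlg.{w, u, v} P} (D : X.Differential) {p q e : ℕ}
    (h : ∑ i, ![p, q] i = e) (h₁ : ∑ i, ![p + 1, q] i = e + 1)
    (h₂ : ∑ i, ![p, q + 1] i = e + 1) (μ : P.obj (Fin 2)) (x : X.obj p) (y : X.obj q) :
    D.δ e (X.op ![p, q] h μ (pair x y)) = X.op ![p + 1, q] h₁ μ (pair (D.δ p x) y) +
      (-1 : k) ^ p • X.op ![p, q + 1] h₂ μ (pair x (D.δ q y)) := by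
  refine (D.leibniz ![p, q] h μ (pair x y)).trans ?_
  refine (X.eps_op_graph (fun a => D.δ a) ![p, q] h μ (pair x y)).symm.trans ?_
  refine Eq.trans ?_ (congrArg Prod.snd
    (X.eps_op_pair h h₁ h₂ μ ((x, D.δ p x) : X.obj p × X.obj (p + 1)) (y, D.δ q y)))
  refine congrArg (fun z => (X.eps.op ![p, q] h μ z).2) (funext fun i => ?_)
  fin_cases i <;> rfl

/-- The square of a derivation of degree one is a derivation. -/
theorem sq_op_eq_zero [CharZero k] (δ : ∀ i, X.obj i →ₗ[k] X.obj (i + 1))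
    (leibniz : ∀ {n : ℕ} (d : Fin n → ℕ) {e : ℕ} (h : ∑ i, d i = e) (μ : P.obj (Fin n))
      (x : ∀ i, X.obj (d i)), δ e (X.op d h μ x) =
        ∑ i, (-1 : k) ^ (∑ j ∈ Finset.univ.filter (· < i), d j) •
          X.op (bumpDeg d i) (sum_bumpDeg d h i) μ (applyAt (X := X.obj) (fun a => δ a) x i))
    {n : ℕ} (d : Fin n → ℕ) {e : ℕ} (h : ∑ i, d i = e) (μ : P.obj (Fin n))
    (x : ∀ i, X.obj (d i)) (hx : ∀ i, δ _ (δ _ (x i)) = 0) : δ _ (δ _ (X.op d h μ x)) = 0 := by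
  let δ' : ∀ i, X.obj i → X.obj (i + 1) := fun a => δ a
  -- `f i j` is the term with `δ` applied first in position `i`, then in position `j`. The diagonal
  -- vanishes by `hx`, and off the diagonal `f` is antisymmetric.
  let f : Fin n → Fin n → X.obj (e + 1 + 1) := fun i j =>
    (leibnizSign k d i * leibnizSign k (bumpDeg d i) j) •
      X.op (bumpDeg (bumpDeg d i) j) (sum_bumpDeg _ (sum_bumpDeg d h i) j) μ
        (applyAt δ' (applyAt δ' x i) j)
  have hf : δ _ (δ _ (X.op d h μ x)) = ∑ i, ∑ j, f i j := by
    rw [leibniz, map_sum]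
    refine Finset.sum_congr rfl fun i _ => ?_
    rw [map_smul, leibniz, Finset.smul_sum]
    refine Finset.sum_congr rfl fun j _ => ?_
    exact smul_smul _ _ _
  have hdiag : ∀ i, f i i = 0 := by
    intro i
    have h0 : applyAt δ' (applyAt δ' x i) i i = 0 := by
      have key : ∀ b : Bool, b = true → applyIf δ' (applyIf δ' (x i) b) b = 0 := by
        rintro _ rfl
        exact hx i
      exact key _ (by simp)
    simp only [f]
    rw [MultilinearMap.map_coord_zero _ i h0, smul_zero]
  have hanti : ∀ i j, f i j = -f j i := by
    intro i j
    by_cases hij : i = j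
    · subst hij
      rw [hdiag, neg_zero]
    · have hs : leibnizSign k d i * leibnizSign k (bumpDeg d i) j =
          -(leibnizSign k d j * leibnizSign k (bumpDeg d j) i) := by
        rw [leibnizSign_bumpDeg, leibnizSign_bumpDeg]
        rcases lt_or_gt_of_ne hij with h' | h'
        · simp [h', h'.not_gt, mul_comm]
        · simp [h', h'.not_gt, mul_comm]
      simp only [f]
      rw [hs, neg_smul]
      congr 2
      refine X.op_congr _ _ (fun l => ?_) μ _ _ fun l => applyAt_applyAt_heq δ' x hij
      simp only [bumpDeg_eq]
      omega
  have hS : ∑ i, ∑ j, f i j = -∑ i, ∑ j, f i j := by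
    conv_lhs => rw [Finset.sum_comm]
    rw [← Finset.sum_neg_distrib]
    refine Finset.sum_congr rfl fun i _ => ?_
    rw [← Finset.sum_neg_distrib]
    exact Finset.sum_congr rfl fun j _ => hanti j i
  rw [hf]
  -- The sum equals its own negative, and 2 is invertible in characteristic zero.
  have h2 : (2 : k) • ∑ i, ∑ j, f i j = 0 := by
    rw [two_smul]
    nth_rewrite 1 [hS]
    exact neg_add_cancel _
  exact (smul_eq_zero.1 h2).resolve_left two_ne_zero

end Operad.SuperAlg

/-! ### Existence of the differential, and forms of degree zero -/

namespace Omega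

variable {P : Operad.{w, u} k} {A : Operad.Alg.{w, u, v} P}

/-- The de Rham differential on the superalgebra of forms. -/
theorem exists_differential [CharZero k] (hP : P.IsBinaryGenerated)
    (A : Operad.Alg.{w, u, v} P) :
    ∃ D : (Omega A).Differential, ∀ a, D.δ 0 (ofA A a) = ofKahler A (kahlerD A a) := by
  -- The morphism `a ↦ a + ε da`, `da ↦ da + ε 0`; the zero encodes `d(da) = 0`.
  obtain ⟨G, hG, hG'⟩ := exists_lift (A := A) hP (Y := (Omega A).eps)
    ((ofAHom A).prod (ofKahlerD A)) (LinearMap.inl k _ _ ∘ₗ ofKahlerD A)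
    (fun μ a b => by
      refine Eq.trans ?_ ((Omega A).eps_op_pair _ (by simp) (by simp) μ
        ((ofA A a, ofKahlerD A a) : (Omega A).obj 0 × (Omega A).obj 1)
        (ofA A b, ofKahlerD A b)).symm
      refine Prod.ext (op_ofA_ofA μ a b).symm ?_
      rw [pow_zero, one_smul]
      exact (ofKahlerD_op μ a b).trans (add_comm _ _))
    (fun μ a b => by
      refine Eq.trans ?_ (congrArg₂
        (fun x y : (Omega A).obj 1 × (Omega A).obj 2 => x + y)
        ((Omega A).eps_op_pair _ (by simp) (by simp) μ
          ((ofA A a, ofKahlerD A a) : (Omega A).obj 0 × (Omega A).obj 1) (ofKahlerD A b, 0))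
        ((Omega A).eps_op_pair _ (by simp) (by simp) μ
          ((ofKahlerD A a, 0) : (Omega A).obj 1 × (Omega A).obj 2)
          (ofA A b, ofKahlerD A b))).symm
      refine Prod.ext (ofKahlerD_op μ a b) ?_
      -- The surviving `ε`-terms are `μ(da, db)` and its negative, the sign coming from moving `ε`
      -- past `da`.
      rw [(Omega A).op_pair_zero_right, (Omega A).op_pair_zero_left, smul_zero]
      change 0 = _ + 0 + (0 + _)
      rw [add_zero, pow_one, neg_one_smul]
      refine (add_neg_cancel _).symm.trans (congrArg _ (zero_add _).symm))
  -- The first component of `G` is the identity on generators, so `G` is the graph of its second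
  -- component `δ`, and the Leibniz rule for `δ` is the multiplicativity of `G`.
  have hfst : ∀ {e : ℕ} (x : (Omega A).obj e), (G.app e x).1 = x := by
    intro e x
    refine mem_of_generators hP
      (fun e => LinearMap.eqLocus (LinearMap.fst k _ _ ∘ₗ G.app e) LinearMap.id) ?_ ?_ ?_ x
    · intro n d e h μ x hx
      refine (congrArg Prod.fst (G.map_op d h μ x)).trans ?_
      exact congrArg ((Omega A).op d h μ) (funext hx)
    · exact fun a => congrArg Prod.fst (hG a)
    · exact fun a => congrArg Prod.fst (hG' a)
  let δ : ∀ e, (Omega A).obj e →ₗ[k] (Omega A).obj (e + 1) :=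
    fun e => LinearMap.snd k _ _ ∘ₗ G.app e
  have hδ : ∀ {e : ℕ} (x : (Omega A).obj e), G.app e x = (x, δ e x) :=
    fun x => Prod.ext (hfst x) rfl
  have leibniz : ∀ {n : ℕ} (d : Fin n → ℕ) {e : ℕ} (h : ∑ i, d i = e) (μ : P.obj (Fin n))
      (x : ∀ i, (Omega A).obj (d i)), δ e ((Omega A).op d h μ x) =
        ∑ i, (-1 : k) ^ (∑ j ∈ Finset.univ.filter (· < i), d j) •
          (Omega A).op (bumpDeg d i) (sum_bumpDeg d h i) μ
            (applyAt (X := (Omega A).obj) (fun a => δ a) x i) := by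
    intro n d e h μ x
    refine Eq.trans ?_ ((Omega A).eps_op_graph (fun a => δ a) d h μ x)
    refine (congrArg Prod.snd (G.map_op d h μ x)).trans ?_
    exact congrArg (fun z => ((Omega A).eps.op d h μ z).2) (funext fun i => hδ (x i))
  have hA : ∀ a, δ 0 (ofA A a) = ofKahler A (kahlerD A a) := fun a => congrArg Prod.snd (hG a)
  have hd : ∀ a, δ 1 (ofKahler A (kahlerD A a)) = 0 := fun a => congrArg Prod.snd (hG' a)
  refine ⟨⟨δ, leibniz, fun e x => ?_⟩, hA⟩
  refine mem_of_generators hP (fun e => LinearMap.ker (δ (e + 1) ∘ₗ δ e)) ?_ ?_ ?_ x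
  · intro n d e h μ x hx
    exact (Omega A).sq_op_eq_zero δ leibniz d h μ x hx
  · intro a
    exact (congrArg (δ 1) (hA a)).trans (hd a)
  · intro a
    exact (congrArg (δ 2) (hd a)).trans (map_zero _)

/-! ### The differential envelope -/

/-- The inclusion of `A` as a morphism to the degree zero part. -/
noncomputable def ofAlg (hP : P.IsBinaryGenerated) (A : Operad.Alg.{w, u, v} P) :
    A.Hom (Omega A).zeroPart :=
  Operad.Alg.Hom.ofBinary hP (ofAHom A) fun μ a b =>
    (op_ofA_ofA μ a b).symm.trans ((Omega A).zeroPart_op_two μ _ _).symm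

/-- Degrees are nonnegative, so an operation with value in degree zero has all its arguments there.
Hence the image of `A`, together with everything in positive degree, is closed under operations. -/
theorem ofA_surjective (hP : P.IsBinaryGenerated) : Function.Surjective (ofA A) := by
  let p : ∀ e, Submodule k ((Omega A).obj e) := fun e =>
    match e with
    | 0 => LinearMap.range (ofAHom A)
    | _ + 1 => ⊤
  intro x
  refine mem_of_generators hP p ?_ (fun a => ⟨a, rfl⟩) (fun a => trivial) x
  intro n d e h μ x hx
  cases e with
  | succ e => trivial
  | zero =>
    obtain rfl : d = fun _ => 0 := funext fun i => by
      simpa using (Finset.sum_eq_zero_iff.1 h) i (Finset.mem_univ i)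
    choose a ha using hx
    obtain rfl : (fun i => ofA A (a i)) = x := funext ha
    exact ⟨A.op μ a, (ofAlg hP A).map_op μ a⟩

end Omega

/-- The algebra `A` as a superalgebra concentrated in degree zero. -/
def Operad.Alg.concentrated {P : Operad.{w, u} k} (A : Operad.Alg.{w, u, v} P) :
    Operad.SuperAlg.{w, u, v} P where
  -- Functions on the proofs of `e = 0`: this is `A` for `e = 0` and zero otherwise, with no case
  -- distinction on `e`.
  obj e := PLift (e = 0) → A.carrier
  op {n} d {e} h :=
    have hd : PLift (e = 0) → ∀ i, PLift (d i = 0) := fun he i =>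
      ⟨Finset.sum_eq_zero_iff.1 (h.trans he.down) i (Finset.mem_univ i)⟩
    { toFun := fun μ => MultilinearMap.pi fun he =>
        (A.op μ).compLinearMap fun i => LinearMap.proj (hd he i)
      map_add' := fun μ μ' => by
        ext x he
        simp
      map_smul' := fun c μ => by
        ext x he
        simp }
  op_perm {n} σ d {e} h h' μ x := by
    funext he
    obtain rfl : d = fun _ => 0 := funext fun i =>
      Finset.sum_eq_zero_iff.1 (h.trans he.down) i (Finset.mem_univ i)
    rw [koszulSign_zero, one_smul]
    exact A.op_perm σ μ _
  op_one {e} h x := by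
    funext he
    exact A.op_one _
  op_comp {n m} d c {e} hc h h' μ ν x := by
    funext he
    exact A.op_comp μ ν _

/-- Sending `a ↦ a` and `da ↦ 0` gives a morphism to `A` concentrated in degree zero, which is a
retraction in degree zero. The Leibniz rule is vacuous because the target vanishes in degree one. -/
theorem Omega.ofA_injective {P : Operad.{w, u} k} {A : Operad.Alg.{w, u, v} P}
    (hP : P.IsBinaryGenerated) : Function.Injective (Omega.ofA A) := by
  let ρ : A.carrier →ₗ[k] A.concentrated.obj 0 := LinearMap.pi fun _ => LinearMap.id
  obtain ⟨F, hF, -⟩ := Omega.exists_lift hP (Y := A.concentrated) ρ 0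
    (fun μ a b => by
      funext he
      refine congrArg (A.op μ) (funext fun i => ?_)
      fin_cases i <;> rfl)
    (fun μ a b => by
      funext he
      exact absurd he.down one_ne_zero)
  intro a b hab
  have h : ρ a = ρ b := (hF a).symm.trans ((congrArg (F.app 0) hab).trans (hF b))
  exact congrFun h ⟨rfl⟩

/-! ### Extension to differential graded superalgebras and naturality -/

namespace Omega

variable {P : Operad.{w, u} k} {A : Operad.Alg.{w, u, v} P}

/-- The forms on which `F` commutes with the differentials are closed under operations, by the
Leibniz rule on both sides. -/
theorem isDG_of_generators (hP : P.IsBinaryGenerated) {Y : Operad.SuperAlg.{w, u, v'} P}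
    (F : (Omega A).Hom Y) (D : (Omega A).Differential) (D' : Y.Differential)
    (hA : ∀ a, F.app 1 (D.δ 0 (ofA A a)) = D'.δ 0 (F.app 0 (ofA A a)))
    (hd : ∀ a, F.app 2 (D.δ 1 (ofKahler A (kahlerD A a))) =
      D'.δ 1 (F.app 1 (ofKahler A (kahlerD A a)))) : F.IsDG D D' := by
  intro e x
  refine mem_of_generators hP
    (fun e => LinearMap.eqLocus (F.app (e + 1) ∘ₗ D.δ e) (D'.δ e ∘ₗ F.app e)) ?_ hA hd x
  intro n d e h μ x hx
  change F.app (e + 1) (D.δ e _) = D'.δ e (F.app e _)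
  rw [D.leibniz, F.map_op, D'.leibniz, map_sum]
  refine Finset.sum_congr rfl fun i _ => ?_
  rw [map_smul, F.map_op]
  congr 2
  funext j
  exact map_applyAt (fun a => D.δ a) x (fun a => D'.δ a) (fun a => F.app a) hx i j

/-- The universal property of the differential envelope. -/
theorem existsUnique_lift (hP : P.IsBinaryGenerated) (D : (Omega A).Differential)
    (hD : ∀ a, D.δ 0 (ofA A a) = ofKahler A (kahlerD A a)) {Y : Operad.SuperAlg.{w, u, v'} P}
    (D' : Y.Differential) (ρ : A.Hom Y.zeroPart) :
    ∃! F : (Omega A).Hom Y, F.IsDG D D' ∧ ∀ a, F.app 0 (ofA A a) = ρ.toFun a := by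
  let ρ' : A.carrier →ₗ[k] Y.obj 0 := ρ.toFun
  have hρ : ∀ (μ : P.obj (Fin 2)) (a b : A.carrier),
      ρ' (A.op μ ![a, b]) = Y.op ![0, 0] (by simp) μ (pair (ρ' a) (ρ' b)) := by
    intro μ a b
    refine (ρ.map_op μ _).trans (Eq.trans ?_ (Y.zeroPart_op_two μ _ _))
    refine congrArg (Y.zeroPart.op μ) (funext fun i => ?_)
    fin_cases i <;> rfl
  -- Commuting with the differentials forces `da ↦ d'(ρ a)`; the Leibniz rule of `D'` makes this
  -- choice admissible.
  obtain ⟨F, hF, hF'⟩ := exists_lift hP ρ' (D'.δ 0 ∘ₗ ρ') hρ (fun μ a b => by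
    rw [LinearMap.comp_apply, hρ]
    refine (D'.op_pair _ (by simp) (by simp) μ _ _).trans ?_
    rw [pow_zero, one_smul]
    exact add_comm _ _)
  have hdd : ∀ a, D.δ 1 (ofKahler A (kahlerD A a)) = 0 := fun a => by
    rw [← hD]
    exact D.sq_zero 0 _
  refine ⟨F, ⟨isDG_of_generators hP F D D' (fun a => ?_) (fun a => ?_), hF⟩, ?_⟩
  · rw [hD, hF', hF]
    rfl
  · rw [hdd, map_zero, hF']
    exact (D'.sq_zero 0 _).symm
  · rintro F₁ ⟨h₁, h₂⟩
    refine hom_ext hP (fun a => (h₂ a).trans (hF a).symm) fun a => ?_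
    rw [← hD, h₁, h₂, hD, hF']
    rfl

/-- The induced morphism exists and is unique, and it commutes with the differentials. -/
theorem induced (hP : P.IsBinaryGenerated) {B : Operad.Alg.{w, u, v} P}
    (D : (Omega A).Differential) (hD : ∀ a, D.δ 0 (ofA A a) = ofKahler A (kahlerD A a))
    (D' : (Omega B).Differential) (hD' : ∀ b, D'.δ 0 (ofA B b) = ofKahler B (kahlerD B b))
    (φ : A.Hom B) :
    (∃! F : (Omega A).Hom (Omega B), IsInduced φ F) ∧
      ∀ F : (Omega A).Hom (Omega B), IsInduced φ F → F.IsDG D D' := by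
  -- The composite `A → B → Ω⁰B`. Its differential graded extension is the induced morphism, since
  -- commuting with `d` sends `da` to `d(φ a)`.
  let ρ : A.Hom (Omega B).zeroPart :=
    ⟨(ofAlg hP B).toFun ∘ₗ φ.toFun, fun μ x =>
      (congrArg (ofAlg hP B).toFun (φ.map_op μ x)).trans ((ofAlg hP B).map_op μ _)⟩
  obtain ⟨F, ⟨hF, hF'⟩, -⟩ := existsUnique_lift hP D hD D' ρ
  have hind : IsInduced φ F := by
    refine ⟨hF', fun a => ?_⟩
    rw [← hD, hF, hF', ← hD']
    rfl
  have huniq : ∀ F₁, IsInduced φ F₁ → F₁ = F := fun F₁ h₁ =>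
    hom_ext hP (fun a => (h₁.1 a).trans (hind.1 a).symm) fun a => (h₁.2 a).trans (hind.2 a).symm
  exact ⟨⟨F, hind, huniq⟩, fun F₁ h₁ => huniq F₁ h₁ ▸ hF⟩

end Omega

end PGeom

theorem mainTheorem12 {k : Type w} [Field k] [CharZero k]
    (P : PGeom.Operad.{w, u} k) (hP : P.IsQuadratic)
    (hP1 : Function.Bijective fun c : k => c • P.one) :
    ∃ d : ∀ A : PGeom.Operad.Alg.{w, u, v} P, (PGeom.Omega A).Differential,
      (∀ (A : PGeom.Operad.Alg.{w, u, v} P) (a : A.carrier),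
        (d A).δ 0 (PGeom.Omega.ofA A a) = PGeom.Omega.ofKahler A (PGeom.kahlerD A a)) ∧
      (∀ (A B : PGeom.Operad.Alg.{w, u, v} P) (φ : A.Hom B),
        (∃! F : (PGeom.Omega A).Hom (PGeom.Omega B), PGeom.Omega.IsInduced φ F) ∧
        ∀ F : (PGeom.Omega A).Hom (PGeom.Omega B), PGeom.Omega.IsInduced φ F →
          F.IsDG (d A) (d B)) ∧
      ∀ A : PGeom.Operad.Alg.{w, u, v} P,
        PGeom.IsDifferentialEnvelope.{w, u, v, max w u v, v'} A (PGeom.Omega A) (d A)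
          (PGeom.Omega.ofA A) := by
  -- The differentials may be chosen independently for each `A`: naturality uses only the values `d
  -- a = da`.
  choose d hd using fun A : PGeom.Operad.Alg.{w, u, v} P =>
    PGeom.Omega.exists_differential hP.generated A
  refine ⟨d, hd, fun A B φ => PGeom.Omega.induced hP.generated _ (hd A) _ (hd B) φ, fun A => ?_⟩
  exact
    { iso := ⟨PGeom.Omega.ofAlg hP.generated A,
        ⟨PGeom.Omega.ofA_injective hP.generated, PGeom.Omega.ofA_surjective hP.generated⟩,
        fun _ => rfl⟩
      universal := fun D' d' ρ =>
        PGeom.Omega.existsUnique_lift hP.generated (d A) (hd A) d' ρ }
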